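/- All spaces are complex. A Banach couple $\mathbf X=(X_0,X_1)$ is a pair of Banach spaces continuously embedded in a common Hausdorff topological vector space; $X_0+X_1$ carries the norm $\inf\{\|x_0\|_{X_0}+\|x_1\|_{X_1}: x=x_0+x_1\}$. Let $\mathcal F(\mathbf X)$ be the space of functions $f$ from the closed annulus $1\le|z|\le e$ to $X_0+X_1$ which are continuous, are analytic for $1<|z|<e$, and for $j=0,1$ are $X_j$-valued and $X_j$-continuous on the circle $|z|=e^j$, with $\|f\|_{\mathcal F}=\max_{j=0,1}\max_{|z|=e^j}\|f(z)\|_{X_j}$. For $0\le\theta\le1$ let $X_\theta=[X_0,X_1]_\theta=\{f(e^\theta):f\in\mathcal F(\mathbf X)\}$ with the norm $\|x\|_{X_\theta}=\inf\{\|f\|_{\mathcal F}:f\in\mathcal F(\mathbf X),\ f(e^\theta)=x\}$. For $f\in\mathcal F(\mathbf X)$ write $f(z)=\sum_{k\in\mathbb Z}\hat f(k)z^k$ for its Laurent expansion in the annulus. **Theorem 6.** Let $\mathbf X$ and $\mathbf Y$ be Banach couples, and let $T:X_0+X_1\to Y_0+Y_1$ be a linear operator which maps $X_j$ boundedly into $Y_j$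 for $j=0,1$ and is such that $T:X_0\to Y_0$ is compact. Let $\mathcal E$ be the set of all $f$ in the unit ball $\{\|f\|_{\mathcal F}\le1\}$ of $\mathcal F(\mathbf X)$ for which the series $\sum_{k\in\mathbb Z}e^{jk}\hat f(k)$ converges unconditionally in $X_j$ for $j=0,1$ and for which $$\Big\|\sum_{k\in\mathbb Z}\lambda_k\hat f(k)\Big\|_{X_0}<1$$ for every sequence of complex scalars $(\lambda_k)_{k\in\mathbb Z}$ with $|\lambda_k|\le1$ for all $k$. Then for every $0<\theta<1$ the set $T(\mathcal E_\theta)$, where $\mathcal E_\theta=\{f(e^\theta):f\in\mathcal E\}$, is contained in $Y_\theta$ and is relatively compact there. -/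

import Mathlib

open Set

noncomputable section

/-- A (complex) Banach couple `(X₀, X₁)`: two complex Banach spaces which are continuously
embedded in a common Hausdorff topological vector space `V`. -/
structure BanachCouple (X₀ X₁ V : Type*)
    [NormedAddCommGroup X₀] [NormedSpace ℂ X₀] [CompleteSpace X₀]
    [NormedAddCommGroup X₁] [NormedSpace ℂ X₁] [CompleteSpace X₁]
    [AddCommGroup V] [Module ℂ V] [TopologicalSpace V] [IsTopologicalAddGroup V]
    [ContinuousSMul ℂ V] [T2Space V] where
  /-- the embedding of `X₀` -/
  ι₀ : X₀ →L[ℂ] V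
  /-- the embedding of `X₁` -/
  ι₁ : X₁ →L[ℂ] V
  injective_ι₀ : Function.Injective ι₀
  injective_ι₁ : Function.Injective ι₁

namespace BanachCouple

section Couple

variable {X₀ X₁ V : Type*}
  [NormedAddCommGroup X₀] [NormedSpace ℂ X₀] [CompleteSpace X₀]
  [NormedAddCommGroup X₁] [NormedSpace ℂ X₁] [CompleteSpace X₁]
  [AddCommGroup V] [Module ℂ V] [TopologicalSpace V] [IsTopologicalAddGroup V]
  [ContinuousSMul ℂ V] [T2Space V]
  (X : BanachCouple X₀ X₁ V)

/-- The map `(x₀, x₁) ↦ x₀ + x₁` into the ambient space; its range is `X₀ + X₁`. The domain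
carries the norm `‖x₀‖ + ‖x₁‖`. -/
def sumMap : WithLp 1 (X₀ × X₁) →L[ℂ] V :=
  (X.ι₀.coprod X.ι₁).comp (WithLp.prodContinuousLinearEquiv 1 ℂ X₀ X₁).toContinuousLinearMap

/-- The pairs `(x₀, x₁)` with `x₀ + x₁ = 0` in the ambient space. -/
def sumKer : Submodule ℂ (WithLp 1 (X₀ × X₁)) := LinearMap.ker X.sumMap.toLinearMap

instance isClosed_sumKer : IsClosed (X.sumKer : Set (WithLp 1 (X₀ × X₁))) :=
  X.sumMap.isClosed_ker

/-- The space `X₀ + X₁`, i.e. the range of `(x₀, x₁) ↦ x₀ + x₁` (written as the quotient by the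
kernel), with its usual norm `‖x‖ = inf {‖x₀‖ + ‖x₁‖ : x = x₀ + x₁}`, which is the quotient
norm. -/
def SumSpace : Type _ := WithLp 1 (X₀ × X₁) ⧸ X.sumKer

instance : NormedAddCommGroup X.SumSpace :=
  inferInstanceAs (NormedAddCommGroup (WithLp 1 (X₀ × X₁) ⧸ X.sumKer))

instance : NormedSpace ℂ X.SumSpace :=
  inferInstanceAs (NormedSpace ℂ (WithLp 1 (X₀ × X₁) ⧸ X.sumKer))

instance : CompleteSpace X.SumSpace :=
  inferInstanceAs (CompleteSpace (WithLp 1 (X₀ × X₁) ⧸ X.sumKer))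

/-- The quotient map `(x₀, x₁) ↦ x₀ + x₁`. -/
def mkSum : WithLp 1 (X₀ × X₁) →ₗ[ℂ] X.SumSpace := X.sumKer.mkQ

lemma mkSum_eq_iff (p q : WithLp 1 (X₀ × X₁)) :
    X.mkSum p = X.mkSum q ↔ X.ι₀ p.fst + X.ι₁ p.snd = X.ι₀ q.fst + X.ι₁ q.snd := by
  refine (Submodule.Quotient.eq X.sumKer).trans ?_
  rw [sumKer, LinearMap.mem_ker, map_sub, sub_eq_zero]
  rfl

lemma norm_mkSum_le (p : WithLp 1 (X₀ × X₁)) : ‖X.mkSum p‖ ≤ ‖p.fst‖ + ‖p.snd‖ := by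
  rw [← WithLp.prod_norm_eq_of_L1]
  exact Submodule.Quotient.norm_mk_le X.sumKer p

/-- The inclusion `X₀ ⊆ X₀ + X₁`. -/
def incl₀ : X₀ →ₗ[ℂ] X.SumSpace where
  toFun x := X.mkSum (WithLp.toLp 1 (x, 0))
  map_add' x y := by rw [← map_add, ← WithLp.toLp_add]; simp
  map_smul' c x := by rw [RingHom.id_apply, ← map_smul, ← WithLp.toLp_smul]; simp

/-- The inclusion `X₁ ⊆ X₀ + X₁`. -/
def incl₁ : X₁ →ₗ[ℂ] X.SumSpace where
  toFun x := X.mkSum (WithLp.toLp 1 (0, x))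
  map_add' x y := by rw [← map_add, ← WithLp.toLp_add]; simp
  map_smul' c x := by rw [RingHom.id_apply, ← map_smul, ← WithLp.toLp_smul]; simp

lemma incl₀_eq_incl₁_iff (x : X₀) (y : X₁) : X.incl₀ x = X.incl₁ y ↔ X.ι₀ x = X.ι₁ y := by
  refine (X.mkSum_eq_iff _ _).trans ?_
  simp

lemma incl₀_injective : Function.Injective X.incl₀ := by
  refine (injective_iff_map_eq_zero X.incl₀).2 fun x hx => ?_
  rw [← map_zero X.incl₁, incl₀_eq_incl₁_iff, map_zero] at hx
  exact X.injective_ι₀ (hx.trans (map_zero _).symm)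

lemma incl₁_injective : Function.Injective X.incl₁ := by
  refine (injective_iff_map_eq_zero X.incl₁).2 fun x hx => ?_
  rw [← map_zero X.incl₀, eq_comm, incl₀_eq_incl₁_iff, map_zero] at hx
  exact X.injective_ι₁ (hx.symm.trans (map_zero _).symm)

/-- The open annulus `1 < |z| < e`. -/
def openAnnulus : Set ℂ := {z | 1 < ‖z‖ ∧ ‖z‖ < Real.exp 1}

/-- The closed annulus `1 ≤ |z| ≤ e`. -/
def closedAnnulus : Set ℂ := {z | 1 ≤ ‖z‖ ∧ ‖z‖ ≤ Real.exp 1}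

/-- An element of Calderón's space `𝓕(X)` on the annulus: a function with values in `X₀ + X₁`,
continuous on the closed annulus and analytic on the open one, which on `|z| = 1` is `X₀`-valued
and `X₀`-continuous and on `|z| = e` is `X₁`-valued and `X₁`-continuous. The values of `toFun`
off the closed annulus play no role anywhere. -/
structure CalderonFun where
  /-- the function itself -/
  toFun : ℂ → X.SumSpace
  /-- `w ↦ f(w)`, `|w| = 1`, as a function with values in `X₀` -/
  bdry₀ : C(Circle, X₀)
  /-- `w ↦ f(e w)`, `|w| = 1`, as a function with values in `X₁` -/
  bdry₁ : C(Circle, X₁)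
  continuousOn : ContinuousOn toFun closedAnnulus
  differentiableOn : DifferentiableOn ℂ toFun openAnnulus
  eq_bdry₀ : ∀ w : Circle, toFun (w : ℂ) = X.incl₀ (bdry₀ w)
  eq_bdry₁ : ∀ w : Circle, toFun ((Real.exp 1 : ℂ) * (w : ℂ)) = X.incl₁ (bdry₁ w)

variable {X}

namespace CalderonFun

/-- `‖f‖_𝓕 = max (max_{|z|=1} ‖f(z)‖_{X₀}, max_{|z|=e} ‖f(z)‖_{X₁})`. -/
def calNorm (f : X.CalderonFun) : ℝ := max ‖f.bdry₀‖ ‖f.bdry₁‖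

/-- The coefficient `f̂(k) ∈ X₀ + X₁` in the Laurent expansion `f(z) = ∑ f̂(k) z^k` in the annulus,
i.e. the `k`-th Fourier coefficient of `f` on the unit circle (by Cauchy's theorem the integral
over any circle `|z| = r`, `1 ≤ r ≤ e`, has the same value). -/
def coeff (f : X.CalderonFun) (k : ℤ) : X.SumSpace :=
  (2 * (Real.pi : ℂ) * Complex.I)⁻¹ • ∮ z in C(0, 1), z ^ (-k - 1) • f.toFun z

lemma calNorm_nonneg (f : X.CalderonFun) : 0 ≤ f.calNorm := le_max_of_le_left (norm_nonneg _)

/-- The zero function. -/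
def zero (X : BanachCouple X₀ X₁ V) : X.CalderonFun where
  toFun _ := 0
  bdry₀ := 0
  bdry₁ := 0
  continuousOn := continuousOn_const
  differentiableOn := differentiableOn_const _
  eq_bdry₀ _ := by simp
  eq_bdry₁ _ := by simp

/-- The sum of two functions. -/
def add (f g : X.CalderonFun) : X.CalderonFun where
  toFun z := f.toFun z + g.toFun z
  bdry₀ := f.bdry₀ + g.bdry₀
  bdry₁ := f.bdry₁ + g.bdry₁
  continuousOn := f.continuousOn.add g.continuousOn
  differentiableOn := f.differentiableOn.add g.differentiableOn
  eq_bdry₀ w := by rw [f.eq_bdry₀, g.eq_bdry₀, ContinuousMap.add_apply, map_add]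
  eq_bdry₁ w := by rw [f.eq_bdry₁, g.eq_bdry₁, ContinuousMap.add_apply, map_add]

/-- A scalar multiple of a function. -/
def smul (c : ℂ) (f : X.CalderonFun) : X.CalderonFun where
  toFun z := c • f.toFun z
  bdry₀ := c • f.bdry₀
  bdry₁ := c • f.bdry₁
  continuousOn := f.continuousOn.const_smul c
  differentiableOn := f.differentiableOn.const_smul c
  eq_bdry₀ w := by rw [f.eq_bdry₀, ContinuousMap.smul_apply, map_smul]
  eq_bdry₁ w := by rw [f.eq_bdry₁, ContinuousMap.smul_apply, map_smul]

lemma calNorm_zero : (zero X).calNorm = 0 := by simp [calNorm, zero]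

lemma calNorm_add_le (f g : X.CalderonFun) : (f.add g).calNorm ≤ f.calNorm + g.calNorm :=
  max_le ((norm_add_le _ _).trans (add_le_add (le_max_left _ _) (le_max_left _ _)))
    ((norm_add_le _ _).trans (add_le_add (le_max_right _ _) (le_max_right _ _)))

lemma calNorm_smul (c : ℂ) (f : X.CalderonFun) : (f.smul c).calNorm = ‖c‖ * f.calNorm := by
  simp only [calNorm, smul, norm_smul]
  exact (mul_max_of_nonneg _ _ (norm_nonneg c)).symm

lemma norm_toFun_le (f : X.CalderonFun) {z : ℂ} (hz : z ∈ closedAnnulus) :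
    ‖f.toFun z‖ ≤ f.calNorm := by
  have h0 : ∀ z : ℂ, ‖z‖ = 1 → ‖f.toFun z‖ ≤ f.calNorm := by
    intro z hz
    obtain ⟨w, rfl⟩ : ∃ w : Circle, (w : ℂ) = z := ⟨⟨z, mem_sphere_zero_iff_norm.2 hz⟩, rfl⟩
    rw [f.eq_bdry₀]
    refine (X.norm_mkSum_le _).trans ?_
    have h2 : ‖f.bdry₀ w‖ ≤ f.calNorm := (f.bdry₀.norm_coe_le_norm _).trans (le_max_left _ _)
    simpa using h2
  have h1 : ∀ z : ℂ, ‖z‖ = Real.exp 1 → ‖f.toFun z‖ ≤ f.calNorm := by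
    intro z hz
    have he : (Real.exp 1 : ℂ) ≠ 0 := by exact_mod_cast (Real.exp_pos 1).ne'
    have hw : ‖(Real.exp 1 : ℂ)⁻¹ * z‖ = 1 := by
      rw [norm_mul, norm_inv, hz, Complex.norm_real, Real.norm_of_nonneg (Real.exp_pos 1).le]
      exact inv_mul_cancel₀ (Real.exp_pos 1).ne'
    obtain ⟨w, rfl⟩ : ∃ w : Circle, (Real.exp 1 : ℂ) * (w : ℂ) = z :=
      ⟨⟨_, mem_sphere_zero_iff_norm.2 hw⟩, mul_inv_cancel_left₀ he z⟩
    rw [f.eq_bdry₁]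
    refine (X.norm_mkSum_le _).trans ?_
    have h2 : ‖f.bdry₁ w‖ ≤ f.calNorm := (f.bdry₁.norm_coe_le_norm _).trans (le_max_right _ _)
    simpa using h2
  have hclosed : IsClosed closedAnnulus :=
    (isClosed_le continuous_const continuous_norm).inter
      (isClosed_le continuous_norm continuous_const)
  have hopen : IsOpen openAnnulus :=
    (isOpen_lt continuous_const continuous_norm).inter
      (isOpen_lt continuous_norm continuous_const)
  have hcl : closure openAnnulus ⊆ closedAnnulus :=
    closure_minimal (fun z hz => ⟨hz.1.le, hz.2.le⟩) hclosed
  have hbdd : Bornology.IsBounded openAnnulus :=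
    (Metric.isBounded_closedBall (x := (0 : ℂ)) (r := Real.exp 1)).subset
      fun z hz => mem_closedBall_zero_iff.2 hz.2.le
  rcases eq_or_lt_of_le hz.1 with h | h
  · exact h0 z h.symm
  rcases eq_or_lt_of_le hz.2 with h' | h'
  · exact h1 z h'
  refine Complex.norm_le_of_forall_mem_frontier_norm_le hbdd
    ⟨f.differentiableOn, f.continuousOn.mono hcl⟩ ?_ (subset_closure ⟨h, h'⟩)
  intro w hw
  rw [hopen.frontier_eq] at hw
  obtain ⟨hw1, hw2⟩ := hcl hw.1
  rcases eq_or_lt_of_le hw1 with k | k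
  · exact h0 w k.symm
  rcases eq_or_lt_of_le hw2 with k' | k'
  · exact h1 w k'
  · exact absurd ⟨k, k'⟩ hw.2

end CalderonFun

/-- The point `e^θ` of the annulus. -/
def expPt (θ : unitInterval) : ℂ := (Real.exp (θ : ℝ) : ℂ)

lemma expPt_mem (θ : unitInterval) : expPt θ ∈ closedAnnulus := by
  have h : ‖expPt θ‖ = Real.exp (θ : ℝ) := by
    rw [expPt, Complex.norm_real, Real.norm_of_nonneg (Real.exp_pos _).le]
  exact ⟨h ▸ Real.one_le_exp θ.2.1, h ▸ Real.exp_le_exp.2 θ.2.2⟩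

variable (X)

/-- The set of all `x ∈ X₀ + X₁` of the form `x = f(e^θ)` with `f ∈ 𝓕(X)`. -/
def interpSubmodule (θ : unitInterval) : Submodule ℂ X.SumSpace where
  carrier := {x | ∃ f : X.CalderonFun, f.toFun (expPt θ) = x}
  zero_mem' := ⟨CalderonFun.zero X, rfl⟩
  add_mem' := by
    rintro _ _ ⟨f, rfl⟩ ⟨g, rfl⟩
    exact ⟨f.add g, rfl⟩
  smul_mem' := by
    rintro c _ ⟨f, rfl⟩
    exact ⟨f.smul c, rfl⟩

/-- Calderón's complex interpolation space `X_θ = [X₀, X₁]_θ`. It is a type of its own, so that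
it carries the interpolation norm and not the one of `X₀ + X₁`. -/
def Interp (θ : unitInterval) : Type _ := X.interpSubmodule θ

namespace Interp

variable {X} {θ : unitInterval}

instance : AddCommGroup (X.Interp θ) := inferInstanceAs (AddCommGroup (X.interpSubmodule θ))

instance : Module ℂ (X.Interp θ) := inferInstanceAs (Module ℂ (X.interpSubmodule θ))

/-- The inclusion `X_θ ⊆ X₀ + X₁`. -/
def toSum : X.Interp θ →ₗ[ℂ] X.SumSpace := (X.interpSubmodule θ).subtype

lemma toSum_injective : Function.Injective (toSum : X.Interp θ → X.SumSpace) :=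
  Subtype.val_injective

/-- `‖x‖_{X_θ} = inf {‖f‖_𝓕 : f ∈ 𝓕(X), f(e^θ) = x}`. -/
instance : Norm (X.Interp θ) where
  norm x := ⨅ f : {f : X.CalderonFun // f.toFun (expPt θ) = toSum x}, f.1.calNorm

lemma norm_def (x : X.Interp θ) :
    ‖x‖ = ⨅ f : {f : X.CalderonFun // f.toFun (expPt θ) = toSum x}, f.1.calNorm := rfl

lemma norm_le (x : X.Interp θ) (f : X.CalderonFun) (hf : f.toFun (expPt θ) = toSum x) :
    ‖x‖ ≤ f.calNorm :=
  ciInf_le (f := fun f : {f : X.CalderonFun // f.toFun (expPt θ) = toSum x} => f.1.calNorm)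
    ⟨0, by rintro _ ⟨g, rfl⟩; exact g.1.calNorm_nonneg⟩ ⟨f, hf⟩

lemma le_norm (x : X.Interp θ) (c : ℝ)
    (h : ∀ f : X.CalderonFun, f.toFun (expPt θ) = toSum x → c ≤ f.calNorm) : c ≤ ‖x‖ := by
  obtain ⟨f, hf⟩ := x.2
  have : Nonempty {f : X.CalderonFun // f.toFun (expPt θ) = toSum x} := ⟨⟨f, hf⟩⟩
  exact le_ciInf fun f => h f.1 f.2

lemma norm_smul_le' (c : ℂ) (x : X.Interp θ) : ‖c • x‖ ≤ ‖c‖ * ‖x‖ := by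
  rcases eq_or_ne c 0 with rfl | hc
  · rw [norm_zero, zero_mul, ← CalderonFun.calNorm_zero (X := X)]
    exact norm_le _ _ (by rw [zero_smul, map_zero]; rfl)
  · rw [← div_le_iff₀' (norm_pos_iff.2 hc)]
    refine le_norm _ _ fun f hf => ?_
    rw [div_le_iff₀' (norm_pos_iff.2 hc), ← CalderonFun.calNorm_smul]
    exact norm_le _ _ (by rw [map_smul, ← hf]; rfl)

lemma core : NormedSpace.Core ℂ (X.Interp θ) where
  norm_nonneg x := le_norm _ _ fun f _ => f.calNorm_nonneg
  norm_smul c x := by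
    refine le_antisymm (norm_smul_le' c x) ?_
    rcases eq_or_ne c 0 with rfl | hc
    · rw [norm_zero, zero_mul]
      exact le_norm _ _ fun f _ => f.calNorm_nonneg
    · have h := norm_smul_le' c⁻¹ (c • x)
      rw [inv_smul_smul₀ hc, norm_inv] at h
      rwa [← le_inv_mul_iff₀ (norm_pos_iff.2 hc)]
  norm_triangle x y := by
    rw [← sub_le_iff_le_add]
    refine le_norm _ _ fun g hg => ?_
    rw [sub_le_comm]
    refine le_norm _ _ fun f hf => ?_
    rw [sub_le_iff_le_add]
    refine (norm_le _ (g.add f) ?_).trans ((g.calNorm_add_le f).trans_eq (add_comm _ _))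
    rw [map_add, ← hf, ← hg]
    rfl
  norm_eq_zero_iff x := by
    constructor
    · intro h
      apply toSum_injective
      rw [map_zero, ← norm_le_zero_iff, ← h]
      refine le_norm _ _ fun f hf => ?_
      rw [← hf]
      exact f.norm_toFun_le (expPt_mem θ)
    · rintro rfl
      refine le_antisymm ?_ (le_norm _ _ fun f _ => f.calNorm_nonneg)
      rw [← CalderonFun.calNorm_zero (X := X)]
      exact norm_le _ _ (by rw [map_zero]; rfl)

instance : NormedAddCommGroup (X.Interp θ) := NormedAddCommGroup.ofCore core

instance : NormedSpace ℂ (X.Interp θ) := NormedSpace.ofCore core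

end Interp

/-- The set `𝓔` of those `f` in the unit ball of `𝓕(X)` whose coefficients `f̂(k)` lie in
`X₀ ∩ X₁`, such that `∑ e^{jk} f̂(k)` converges unconditionally in `X_j` for `j = 0, 1`, and such
that `‖∑ λ_k f̂(k)‖_{X₀} < 1` whenever `|λ_k| ≤ 1` for all `k`. (`Summable` over `ℤ` is
unconditional convergence; in a Banach space it implies the convergence of all the sums
`∑ λ_k f̂(k)`.) -/
def unconditionalSet : Set X.CalderonFun :=
  {f | f.calNorm ≤ 1 ∧
    (∃ a₀ : ℤ → X₀, (∀ k, X.incl₀ (a₀ k) = f.coeff k) ∧ Summable a₀ ∧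
      ∀ l : ℤ → ℂ, (∀ k, ‖l k‖ ≤ 1) → ‖∑' k, l k • a₀ k‖ < 1) ∧
    (∃ a₁ : ℤ → X₁, (∀ k, X.incl₁ (a₁ k) = f.coeff k) ∧
      Summable fun k : ℤ => (Real.exp (k : ℝ) : ℂ) • a₁ k)}

/-- For a set `E ⊆ 𝓕(X)`, the set `E_θ = {f(e^θ) : f ∈ E}`. -/
def valueSet (E : Set X.CalderonFun) (θ : unitInterval) : Set X.SumSpace :=
  (fun f : X.CalderonFun => f.toFun (expPt θ)) '' E

/-- A subset of `X₀ + X₁` is a relatively compact subset of `X_θ` if it is contained in `X_θ`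
and has compact closure there. -/
def IsRelativelyCompactIn (θ : unitInterval) (S : Set X.SumSpace) : Prop :=
  S ⊆ Set.range (Interp.toSum : X.Interp θ → X.SumSpace) ∧
    IsCompact (closure ((Interp.toSum : X.Interp θ → X.SumSpace) ⁻¹' S))

end Couple

section Hom

variable {X₀ X₁ V Y₀ Y₁ W : Type*}
  [NormedAddCommGroup X₀] [NormedSpace ℂ X₀] [CompleteSpace X₀]
  [NormedAddCommGroup X₁] [NormedSpace ℂ X₁] [CompleteSpace X₁]
  [AddCommGroup V] [Module ℂ V] [TopologicalSpace V] [IsTopologicalAddGroup V]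
  [ContinuousSMul ℂ V] [T2Space V]
  [NormedAddCommGroup Y₀] [NormedSpace ℂ Y₀] [CompleteSpace Y₀]
  [NormedAddCommGroup Y₁] [NormedSpace ℂ Y₁] [CompleteSpace Y₁]
  [AddCommGroup W] [Module ℂ W] [TopologicalSpace W] [IsTopologicalAddGroup W]
  [ContinuousSMul ℂ W] [T2Space W]

/-- A linear operator `T : X → Y` between Banach couples: a linear map `X₀ + X₁ → Y₀ + Y₁` which
maps `X_j` into `Y_j` boundedly for `j = 0, 1`; the restrictions are recorded as `map₀`, `map₁`. -/
structure Hom (X : BanachCouple X₀ X₁ V) (Y : BanachCouple Y₀ Y₁ W) where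
  /-- the operator on `X₀ + X₁` -/
  map : X.SumSpace →ₗ[ℂ] Y.SumSpace
  /-- its restriction to `X₀` -/
  map₀ : X₀ →L[ℂ] Y₀
  /-- its restriction to `X₁` -/
  map₁ : X₁ →L[ℂ] Y₁
  map_incl₀ : ∀ x, map (X.incl₀ x) = Y.incl₀ (map₀ x)
  map_incl₁ : ∀ x, map (X.incl₁ x) = Y.incl₁ (map₁ x)

end Hom

end BanachCouple

end

/-!
Write `y_k = T f̂(k)` for `f ∈ 𝓔`. All sums `∑ λ_k y_k` over finite sets with `|λ_k| ≤ 1` lie in one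
totally bounded subset `D` of `Y₀`, and the elements of `D` belong to `Y₁` as well. The set of values
`T f(e^θ)` is totally bounded in `Y_θ` because the Fejér means of `g = T ∘ f` converge to `g` at
`e^θ` uniformly over `f ∈ 𝓔` (`exists_norm_value_sub_fejer_le`), while a Fejér mean of fixed order
involves boundedly many coefficients, which are bounded in `Y₁` and precompact in `Y₀`
(`totallyBounded_image_value`). As `Y_θ` is complete, its totally bounded sets have compact closure.

The uniform convergence rests on the inequality that a function in `𝓕(Y)` with a bound on the outer
circle and a small norm on the inner circle is small in `Y_θ` at `e^θ`
(`Interp.exists_norm_value_le`). The remainder `g - σ_N g` has outer norm at most `2 ‖g‖`, and its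
coefficients are `m_k y_k` with `0 ≤ m_k ≤ min(1, |k| / N)`. On the inner circle the partial
sums of its part with `k ≥ 0` lie in `D`, with `Y₁`-norm `O(1 / N)` because `‖y_k‖ ≤ C e^{-k}` in `Y₁`;
on a totally bounded set this forces smallness in `Y₀` (`exists_norm_le_of_totallyBounded`). For `k < 0`
there is no such decay. There `TotallyBounded.exists_finite_approx_sum` replaces the family `(y_k)`,
with a small error in `Y₀` uniformly over multipliers, by a family `(w_k v_k)` with `0 ≤ w_k ≤ 1` and
with `v_k` from a finite subset of `D` which does not depend on `f`. The finitely many `v_k` have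
bounded norms in `Y₀` and `Y₁`, so that `∑_{k < 0} m_k w_k v_k z ^ k` is `O(1 / N)` both in `Y₁` on the
outer circle and in `Y_θ` at `e^θ`, and subtracting it leaves a function to which the inequality
applies.

The approximation lemma needs no approximation property of `Y₀`: the operator `λ ↦ ∑ λ_k y_k` is
compact on a space whose dual is `ℓ₁`, where conditional expectations onto partitions into finitely
many cells give uniform finite-rank approximations.
-/

/-! ### Unconditional sums -/

/-- A finite sum of absolute values is at most four times the largest modulus of a partial sum:
split the terms by the signs of their real and of their imaginary parts. -/
lemma sum_norm_le_four_mul {ι : Type*} (t : Finset ι) (z : ι → ℂ) (C : ℝ)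
    (h : ∀ s ⊆ t, ‖∑ k ∈ s, z k‖ ≤ C) : ∑ k ∈ t, ‖z k‖ ≤ 4 * C := by
  classical
  have key : ∀ u : ι → ℝ, (∀ s ⊆ t, |∑ k ∈ s, u k| ≤ C) → ∑ k ∈ t, |u k| ≤ 2 * C := by
    intro u hu
    have h1 := hu _ (t.filter_subset fun k => 0 ≤ u k)
    have h2 := hu _ (t.filter_subset fun k => ¬ 0 ≤ u k)
    rw [← Finset.sum_filter_add_sum_filter_not t (fun k => 0 ≤ u k)]
    have e1 : ∑ k ∈ t with 0 ≤ u k, |u k| = ∑ k ∈ t with 0 ≤ u k, u k :=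
      Finset.sum_congr rfl fun k hk => abs_of_nonneg (Finset.mem_filter.1 hk).2
    have e2 : ∑ k ∈ t with ¬ 0 ≤ u k, |u k| = - ∑ k ∈ t with ¬ 0 ≤ u k, u k := by
      rw [← Finset.sum_neg_distrib]
      exact Finset.sum_congr rfl fun k hk =>
        abs_of_neg (not_le.1 (Finset.mem_filter.1 hk).2)
    rw [e1, e2]
    linarith [le_abs_self (∑ k ∈ t with 0 ≤ u k, u k),
      neg_abs_le (∑ k ∈ t with ¬ 0 ≤ u k, u k)]
  have hre := key (fun k => (z k).re) fun s hs => by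
    rw [← Complex.re_sum]; exact (Complex.abs_re_le_norm _).trans (h s hs)
  have him := key (fun k => (z k).im) fun s hs => by
    rw [← Complex.im_sum]; exact (Complex.abs_im_le_norm _).trans (h s hs)
  calc ∑ k ∈ t, ‖z k‖ ≤ ∑ k ∈ t, (|(z k).re| + |(z k).im|) :=
        Finset.sum_le_sum fun k _ => Complex.norm_le_abs_re_add_abs_im _
    _ ≤ 4 * C := by rw [Finset.sum_add_distrib]; linarith

/-- The tails of an unconditionally convergent series are small uniformly over all bounded scalar
multipliers. -/
lemma Summable.exists_finset_norm_sum_smul_le {ι E : Type*} [NormedAddCommGroup E]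
    [NormedSpace ℂ E] [CompleteSpace E] {a : ι → E} (ha : Summable a) {ε : ℝ} (hε : 0 < ε) :
    ∃ t : Finset ι, ∀ s : Finset ι, Disjoint s t → ∀ l : ι → ℂ, (∀ k, ‖l k‖ ≤ 1) →
      ‖∑ k ∈ s, l k • a k‖ ≤ ε := by
  obtain ⟨t, ht⟩ := summable_iff_vanishing_norm.1 ha (ε / 4) (by positivity)
  refine ⟨t, fun s hs l hl => ?_⟩
  obtain ⟨φ, hφ, hφe⟩ := exists_dual_vector'' ℂ (∑ k ∈ s, l k • a k)
  have h4 : ∑ k ∈ s, ‖φ (a k)‖ ≤ 4 * (ε / 4) := by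
    refine sum_norm_le_four_mul s _ _ fun r hr => ?_
    rw [← map_sum]
    refine (φ.le_of_opNorm_le hφ _).trans ?_
    rw [one_mul]
    exact (ht r (hs.mono_left hr)).le
  have hn : ‖∑ k ∈ s, l k • a k‖ = ‖φ (∑ k ∈ s, l k • a k)‖ := by
    rw [hφe]; simp
  rw [hn, map_sum]
  refine (norm_sum_le _ _).trans (le_trans (Finset.sum_le_sum fun k _ => ?_) (h4.trans_eq (by ring)))
  rw [map_smul, norm_smul]
  exact mul_le_of_le_one_left (norm_nonneg _) (hl k)

/-- If all sums `∑ λ_k z_k` with `|λ_k| ≤ 1` have modulus at most `C`, then `∑ |z_k| ≤ C`. -/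
lemma sum_norm_le_of_forall_norm_sum_mul_le {ι : Type*} (t : Finset ι) (z : ι → ℂ) (C : ℝ)
    (h : ∀ l : ι → ℂ, (∀ k, ‖l k‖ ≤ 1) → ‖∑ k ∈ t, l k * z k‖ ≤ C) : ∑ k ∈ t, ‖z k‖ ≤ C := by
  have hl : ∀ k, ‖(starRingEnd ℂ) (z k) / (‖z k‖ : ℂ)‖ ≤ 1 := fun k => by
    rw [norm_div, RCLike.norm_conj, Complex.norm_real, norm_norm]
    exact div_self_le_one _
  have h1 := h _ hl
  have h2 : ∑ k ∈ t, (starRingEnd ℂ) (z k) / (‖z k‖ : ℂ) * z k = ((∑ k ∈ t, ‖z k‖ : ℝ) : ℂ) := by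
    rw [Complex.ofReal_sum]
    refine Finset.sum_congr rfl fun k _ => ?_
    rcases eq_or_ne (z k) 0 with hz | hz
    · simp [hz]
    · have : (‖z k‖ : ℂ) ≠ 0 := by exact_mod_cast norm_ne_zero_iff.2 hz
      rw [div_mul_eq_mul_div, Complex.conj_mul', sq, mul_div_assoc, div_self this, mul_one]
  rw [h2, Complex.norm_real] at h1
  exact (le_abs_self _).trans h1

/-! ### Approximation of operators on `c₀` with values in a compact set -/

/-- Finitely many functionals of norm at most one approximate all of them uniformly on a totally
bounded set. -/
lemma TotallyBounded.exists_finite_dual_net {E : Type*} [NormedAddCommGroup E] [NormedSpace ℂ E]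
    {D : Set E} (hD : TotallyBounded D) {ε : ℝ} (hε : 0 < ε) :
    ∃ (F : Finset (StrongDual ℂ E)), (∀ ψ ∈ F, ‖ψ‖ ≤ 1) ∧
      ∀ φ : StrongDual ℂ E, ‖φ‖ ≤ 1 → ∃ ψ ∈ F, ∀ x ∈ D, ‖φ x - ψ x‖ ≤ ε := by
  obtain ⟨N, hN, hcov⟩ := Metric.totallyBounded_iff.1 hD (ε / 3) (by positivity)
  have : Fintype N := hN.fintype
  let ev : StrongDual ℂ E → (N → ℂ) := fun φ i => φ i
  have hb : TotallyBounded (ev '' {φ | ‖φ‖ ≤ 1}) := by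
    refine TotallyBounded.subset (s₂ := Set.pi univ fun i : N => Metric.closedBall (0 : ℂ) ‖(i : E)‖)
      ?_ (isCompact_univ_pi fun i : N => isCompact_closedBall (0 : ℂ) ‖(i : E)‖).totallyBounded
    rintro _ ⟨φ, hφ, rfl⟩ i -
    rw [mem_closedBall_zero_iff]
    exact (φ.le_of_opNorm_le hφ _).trans_eq (one_mul _)
  obtain ⟨S, hS, hSf, hScov⟩ :=
    totallyBounded_iff_subset.1 hb _ (Metric.dist_mem_uniformity (ε := ε / 3) (by positivity))
  choose g hg hge using hS
  classical
  have : Finite S := hSf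
  let G : S → StrongDual ℂ E := fun s => g s.2
  refine ⟨(finite_range G).toFinset, ?_, fun φ hφ => ?_⟩
  · intro ψ hψ
    obtain ⟨s, rfl⟩ := (finite_range G).mem_toFinset.1 hψ
    exact hg s.2
  · have := hScov ⟨φ, hφ, rfl⟩
    simp only [mem_iUnion, mem_ofPred_eq] at this
    obtain ⟨s, hs, hd⟩ := this
    refine ⟨g hs, (finite_range G).mem_toFinset.2 ⟨⟨s, hs⟩, rfl⟩, fun x hx => ?_⟩
    have hx' := hcov hx
    simp only [mem_iUnion, Metric.mem_ball] at hx'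
    obtain ⟨i, hi, hxi⟩ := hx'
    have hd' : dist (ev φ) (ev (g hs)) < ε / 3 := by rw [show ev (g hs) = s from hge hs]; exact hd
    have h1 : ‖φ i - g hs i‖ < ε / 3 := by
      have := (dist_le_pi_dist (ev φ) (ev (g hs)) ⟨i, hi⟩).trans_lt hd'
      rwa [dist_eq_norm] at this
    have h2 : ∀ χ : StrongDual ℂ E, ‖χ‖ ≤ 1 → ‖χ x - χ i‖ ≤ ε / 3 := fun χ hχ => by
      rw [← map_sub]
      refine (χ.le_of_opNorm_le hχ _).trans ?_
      rw [one_mul, ← dist_eq_norm]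
      exact hxi.le
    have h3 := h2 φ hφ
    have h4 := h2 (g hs) (hg hs)
    calc ‖φ x - g hs x‖ = ‖(φ x - φ i) + (φ i - g hs i) - (g hs x - g hs i)‖ := by congr 1; ring
      _ ≤ ‖φ x - φ i‖ + ‖φ i - g hs i‖ + ‖g hs x - g hs i‖ :=
        (norm_sub_le _ _).trans (add_le_add_left (norm_add_le _ _) _)
      _ ≤ ε := by linarith

/-- A finite colouring of the closed unit disc of `ℂ` with colour classes of small diameter. -/
lemma exists_fin_coloring_closedBall {ε : ℝ} (hε : 0 < ε) :
    ∃ (p : ℕ) (κ : ℂ → Fin p), ∀ z w : ℂ, ‖z‖ ≤ 1 → ‖w‖ ≤ 1 → κ z = κ w → ‖z - w‖ ≤ ε := by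
  obtain ⟨S, hS, hcov⟩ := Metric.totallyBounded_iff.1
    (isCompact_closedBall (0 : ℂ) 1).totallyBounded (ε / 2) (by positivity)
  have h : ∀ z : Metric.closedBall (0 : ℂ) 1, ∃ s : S, dist (z : ℂ) s < ε / 2 := fun z => by
    have := hcov z.2
    simp only [mem_iUnion, Metric.mem_ball] at this
    obtain ⟨s, hs, h⟩ := this
    exact ⟨⟨s, hs⟩, h⟩
  choose c hc using h
  have : Fintype S := hS.fintype
  have h0 : (0 : ℂ) ∈ Metric.closedBall (0 : ℂ) 1 := by simp
  classical
  refine ⟨Fintype.card S, fun z => Fintype.equivFin S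
    (if hz : z ∈ Metric.closedBall (0 : ℂ) 1 then c ⟨z, hz⟩ else c ⟨0, h0⟩), ?_⟩
  intro z w hz hw hzw
  have hz' : z ∈ Metric.closedBall (0 : ℂ) 1 := mem_closedBall_zero_iff.2 hz
  have hw' : w ∈ Metric.closedBall (0 : ℂ) 1 := mem_closedBall_zero_iff.2 hw
  have := (Fintype.equivFin S).injective hzw
  rw [dif_pos hz', dif_pos hw'] at this
  have h1 := hc ⟨z, hz'⟩
  have h2 := hc ⟨w, hw'⟩
  rw [← this] at h2
  rw [← dist_eq_norm]
  linarith [dist_triangle_right z w (c ⟨z, hz'⟩ : ℂ)]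

/-- Uniform finite-rank approximation of unconditional families. For a totally bounded set `D` and
`ε > 0` there is a finite set `V ⊆ D` such that every finite family `(y_k)` all of whose sums
`∑ λ_k y_k` with `|λ_k| ≤ 1` lie in `D` is within `ε`, uniformly in `λ`, of a family
`(w_k v_k)` with `v_k ∈ V` and `0 ≤ w_k ≤ 1`. The set `V` depends neither on the family nor on the
number of its members.

The adjoint of `λ ↦ ∑ λ_k y_k` maps the dual ball to a totally bounded subset of `ℓ₁`, with nets of
a size depending on `D` only. Finitely many elements `a_ψ` of `ℓ₁` are almost fixed by the
conditional expectation, with respect to the weight `ν = ∑ |a_ψ|`, onto a partition into boundedly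
many cells: the level sets of the discretized densities `a_ψ / ν`. -/
lemma TotallyBounded.exists_finite_approx_sum {E : Type*} [NormedAddCommGroup E] [NormedSpace ℂ E]
    (ι : Type*) {D : Set E} (hD : TotallyBounded D) {ε : ℝ} (hε : 0 < ε) :
    ∃ V : Set E, V.Finite ∧ V ⊆ D ∧ ∀ (t : Finset ι) (y : ι → E),
      (∀ l : ι → ℂ, (∀ k, ‖l k‖ ≤ 1) → ∑ k ∈ t, l k • y k ∈ D) →
      ∃ (v : ι → E) (w : ι → ℝ), (∀ k, v k ∈ V) ∧ (∀ k ∈ t, 0 ≤ w k ∧ w k ≤ 1) ∧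
        ∀ l : ι → ℂ, (∀ k, ‖l k‖ ≤ 1) → ‖∑ k ∈ t, l k • (y k - (w k : ℂ) • v k)‖ ≤ ε := by
  classical
  obtain ⟨R, hR⟩ := hD.isBounded.subset_closedBall 0
  obtain ⟨F, hF1, hF⟩ := hD.exists_finite_dual_net (ε := ε / 8) (by positivity)
  obtain ⟨p, κ, hκ⟩ := exists_fin_coloring_closedBall
    (ε := ε / (4 * (F.card * |R| + 1))) (by positivity)
  -- a cell is a choice of a colour for each of the finitely many densities
  set n : ℕ := Fintype.card (F → Fin p)
  obtain ⟨V, hVD, hVf, hVcov⟩ := totallyBounded_iff_subset.1 hD _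
    (Metric.dist_mem_uniformity (ε := ε / (2 * (n + 1))) (by positivity))
  refine ⟨V, hVf, hVD, fun t y hy => ?_⟩
  have hDn : ∀ x ∈ D, ‖x‖ ≤ |R| := fun x hx =>
    (mem_closedBall_zero_iff.1 (hR hx)).trans (le_abs_self R)
  have hone : ∀ ψ ∈ F, ∀ x : E, ‖ψ x‖ ≤ ‖x‖ := fun ψ hψ x =>
    (ψ.le_of_opNorm_le (hF1 ψ hψ) x).trans_eq (one_mul _)
  have hsum1 : ∀ ψ ∈ F, ∑ k ∈ t, ‖ψ (y k)‖ ≤ |R| := fun ψ hψ => by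
    refine sum_norm_le_of_forall_norm_sum_mul_le t _ _ fun l hl => ?_
    have : ∑ k ∈ t, l k * ψ (y k) = ψ (∑ k ∈ t, l k • y k) := by simp
    rw [this]
    exact (hone ψ hψ _).trans (hDn _ (hy l hl))
  let ν : ι → ℝ := fun k => ∑ ψ ∈ F, ‖ψ (y k)‖
  have hν0 : ∀ k, 0 ≤ ν k := fun k => Finset.sum_nonneg fun _ _ => norm_nonneg _
  have hνle : ∀ ψ ∈ F, ∀ k, ‖ψ (y k)‖ ≤ ν k := fun ψ hψ k =>
    Finset.single_le_sum (f := fun ψ : StrongDual ℂ E => ‖ψ (y k)‖)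
      (fun _ _ => norm_nonneg _) hψ
  have hνsum : ∑ k ∈ t, ν k ≤ F.card * |R| := by
    rw [Finset.sum_comm, ← nsmul_eq_mul]
    exact Finset.sum_le_card_nsmul _ _ _ hsum1
  let d : StrongDual ℂ E → ι → ℂ := fun ψ k => ψ (y k) / (ν k : ℂ)
  have hd1 : ∀ ψ ∈ F, ∀ k, ‖d ψ k‖ ≤ 1 := fun ψ hψ k => by
    simp only [d]
    rw [norm_div, Complex.norm_real, Real.norm_of_nonneg (hν0 k)]
    exact div_le_one_of_le₀ (hνle ψ hψ k) (hν0 k)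
  have hdν : ∀ ψ ∈ F, ∀ k, d ψ k * (ν k : ℂ) = ψ (y k) := fun ψ hψ k => by
    rcases eq_or_ne (ν k) 0 with h | h
    · have : ψ (y k) = 0 := norm_le_zero_iff.1 (h ▸ hνle ψ hψ k)
      rw [h, this]; simp
    · exact div_mul_cancel₀ _ (by exact_mod_cast h)
  let cell : ι → (F → Fin p) := fun k ψ => κ (d ψ k)
  let Λ : (F → Fin p) → ℝ := fun c => ∑ k ∈ t with cell k = c, ν k
  let w : ι → ℝ := fun k => ν k / Λ (cell k)
  have hΛ0 : ∀ c, 0 ≤ Λ c := fun c => Finset.sum_nonneg fun _ _ => hν0 _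
  have hνΛ : ∀ k ∈ t, ν k ≤ Λ (cell k) := fun k hk =>
    Finset.single_le_sum (f := ν) (fun _ _ => hν0 _) (Finset.mem_filter.2 ⟨hk, rfl⟩)
  have hw0 : ∀ k, 0 ≤ w k := fun k => div_nonneg (hν0 k) (hΛ0 _)
  have hwΛ : ∀ k ∈ t, w k * Λ (cell k) = ν k := fun k hk => by
    rcases eq_or_ne (Λ (cell k)) 0 with h | h
    · rw [h, mul_zero]
      exact le_antisymm (hν0 k) (h ▸ hνΛ k hk)
    · exact div_mul_cancel₀ _ h
  have hwsum : ∀ c, ∑ k ∈ t with cell k = c, w k ≤ 1 := fun c => by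
    have : ∑ k ∈ t with cell k = c, w k = (∑ k ∈ t with cell k = c, ν k) / Λ c := by
      rw [Finset.sum_div]
      refine Finset.sum_congr rfl fun k hk => ?_
      simp only [w]
      rw [(Finset.mem_filter.1 hk).2]
    rw [this]
    exact div_self_le_one _
  have hw1 : ∀ k ∈ t, w k ≤ 1 := fun k hk => div_le_one_of_le₀ (hνΛ k hk) (hΛ0 _)
  let u : (F → Fin p) → E := fun c => ∑ k ∈ t with cell k = c, y k
  have huD : ∀ c, u c ∈ D := fun c => by
    have := hy (fun k => if cell k = c then 1 else 0) fun k => by split_ifs <;> simp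
    simpa [u, Finset.sum_filter] using this
  have hV : ∀ c, ∃ v ∈ V, ‖u c - v‖ ≤ ε / (2 * (n + 1)) := fun c => by
    have := hVcov (huD c)
    simp only [mem_iUnion, mem_ofPred_eq] at this
    obtain ⟨v, hv, h⟩ := this
    exact ⟨v, hv, by rw [← dist_eq_norm]; exact h.le⟩
  choose v hvV hv using hV
  refine ⟨fun k => v (cell k), w, fun k => hvV _, fun k hk => ⟨hw0 k, hw1 k hk⟩, fun l hl => ?_⟩
  have hsplit : ∑ k ∈ t, l k • (y k - (w k : ℂ) • v (cell k)) =
      ∑ k ∈ t, l k • (y k - (w k : ℂ) • u (cell k)) +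
        ∑ k ∈ t, (l k * (w k : ℂ)) • (u (cell k) - v (cell k)) := by
    rw [← Finset.sum_add_distrib]
    refine Finset.sum_congr rfl fun k _ => ?_
    rw [mul_smul, ← smul_add]
    congr 1
    rw [smul_sub]
    abel
  -- replacing the cell sums by points of `V`
  have hsecond : ‖∑ k ∈ t, (l k * (w k : ℂ)) • (u (cell k) - v (cell k))‖ ≤ ε / 2 := by
    have h1 : ∀ k ∈ t, ‖(l k * (w k : ℂ)) • (u (cell k) - v (cell k))‖ ≤
        w k * (ε / (2 * (n + 1))) := fun k _ => by
      rw [norm_smul, norm_mul, Complex.norm_real, Real.norm_of_nonneg (hw0 k)]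
      exact mul_le_mul (mul_le_of_le_one_left (hw0 k) (hl k)) (hv _) (norm_nonneg _) (hw0 k)
    refine (norm_sum_le_of_le _ h1).trans ?_
    rw [← Finset.sum_mul]
    have h2 : ∑ k ∈ t, w k ≤ n := by
      rw [← Finset.sum_fiberwise t cell]
      refine (Finset.sum_le_card_nsmul _ _ 1 fun c _ => hwsum c).trans_eq ?_
      rw [Finset.card_univ, nsmul_eq_mul, mul_one]
    calc (∑ k ∈ t, w k) * (ε / (2 * (n + 1))) ≤ (n + 1) * (ε / (2 * (n + 1))) := by
          gcongr; linarith
      _ = ε / 2 := by field_simp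
  -- replacing the family by its conditional expectation
  have hfirst : ‖∑ k ∈ t, l k • (y k - (w k : ℂ) • u (cell k))‖ ≤ ε / 2 := by
    set z := ∑ k ∈ t, l k • (y k - (w k : ℂ) • u (cell k)) with hz
    let μ : ι → ℂ := fun k' => ∑ k ∈ t with cell k = cell k', l k * (w k : ℂ)
    have hμ : ∀ k, ‖μ k‖ ≤ 1 := fun k' => by
      refine (norm_sum_le_of_le _ fun k _ => ?_).trans (hwsum (cell k'))
      rw [norm_mul, Complex.norm_real, Real.norm_of_nonneg (hw0 k)]
      exact mul_le_of_le_one_left (hw0 k) (hl k)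
    have hz' : z = ∑ k ∈ t, l k • y k - ∑ k ∈ t, μ k • y k := by
      simp only [hz, smul_sub, Finset.sum_sub_distrib, μ, u, Finset.sum_smul, Finset.smul_sum,
        smul_smul]
      congr 1
      refine Finset.sum_comm' fun a b => ?_
      simp only [Finset.mem_filter]
      constructor
      · rintro ⟨h1, h2, h3⟩; exact ⟨⟨h1, h3.symm⟩, h2⟩
      · rintro ⟨⟨h1, h3⟩, h2⟩; exact ⟨h1, h2, h3.symm⟩
    obtain ⟨φ, hφ, hφz⟩ := exists_dual_vector'' ℂ z
    obtain ⟨ψ, hψ, hφψ⟩ := hF φ hφ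
    have hdiff : ‖φ z - ψ z‖ ≤ ε / 8 + ε / 8 := by
      rw [hz', map_sub, map_sub, sub_sub_sub_comm]
      exact (norm_sub_le _ _).trans (add_le_add (hφψ _ (hy l hl)) (hφψ _ (hy μ hμ)))
    have hψz : ‖ψ z‖ ≤ ε / 4 := by
      have h1 : ∀ k ∈ t, ‖l k * (ψ (y k) - (w k : ℂ) * ψ (u (cell k)))‖ ≤
          ν k * (ε / (4 * (F.card * |R| + 1))) := fun k hk => by
        have e1 : ψ (y k) - (w k : ℂ) * ψ (u (cell k)) =
            (w k : ℂ) * ∑ k' ∈ t with cell k' = cell k, (ν k' : ℂ) * (d ψ k - d ψ k') := by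
          have e2 : ∑ k' ∈ t with cell k' = cell k, (ν k' : ℂ) * (d ψ k - d ψ k') =
              d ψ k * (Λ (cell k) : ℂ) - ψ (u (cell k)) := by
            simp only [u, Λ, map_sum, Complex.ofReal_sum, Finset.mul_sum]
            rw [← Finset.sum_sub_distrib]
            refine Finset.sum_congr rfl fun k' _ => ?_
            rw [← hdν ψ hψ k']
            ring
          have e3 : (w k : ℂ) * (Λ (cell k) : ℂ) = (ν k : ℂ) := by exact_mod_cast hwΛ k hk
          rw [e2, mul_sub, mul_left_comm, e3, hdν ψ hψ]
        rw [norm_mul, e1, norm_mul, Complex.norm_real, Real.norm_of_nonneg (hw0 k)]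
        refine (mul_le_of_le_one_left (by positivity [hw0 k]) (hl k)).trans ?_
        have h2 : ‖∑ k' ∈ t with cell k' = cell k, (ν k' : ℂ) * (d ψ k - d ψ k')‖ ≤
            Λ (cell k) * (ε / (4 * (F.card * |R| + 1))) := by
          simp only [Λ]
          rw [Finset.sum_mul]
          refine norm_sum_le_of_le _ fun k' hk' => ?_
          rw [norm_mul, Complex.norm_real, Real.norm_of_nonneg (hν0 k')]
          refine mul_le_mul_of_nonneg_left (hκ _ _ (hd1 ψ hψ k) (hd1 ψ hψ k') ?_) (hν0 k')
          exact (congr_fun (Finset.mem_filter.1 hk').2 ⟨ψ, hψ⟩).symm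
        refine (mul_le_mul_of_nonneg_left h2 (hw0 k)).trans_eq ?_
        rw [← mul_assoc, hwΛ k hk]
      have h3 : ψ z = ∑ k ∈ t, l k * (ψ (y k) - (w k : ℂ) * ψ (u (cell k))) := by
        simp only [hz, map_sum, map_smul, map_sub, smul_eq_mul]
      rw [h3]
      refine (norm_sum_le_of_le _ h1).trans ?_
      rw [← Finset.sum_mul]
      calc (∑ k ∈ t, ν k) * (ε / (4 * (F.card * |R| + 1)))
          ≤ (F.card * |R| + 1) * (ε / (4 * (F.card * |R| + 1))) := by gcongr; linarith
        _ = ε / 4 := by field_simp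
    have hnz : ‖z‖ = ‖φ z‖ := by rw [hφz]; simp
    rw [hnz]
    calc ‖φ z‖ = ‖(φ z - ψ z) + ψ z‖ := by rw [sub_add_cancel]
      _ ≤ ‖φ z - ψ z‖ + ‖ψ z‖ := norm_add_le _ _
      _ ≤ ε / 2 := by linarith
  rw [hsplit]
  exact (norm_add_le _ _).trans (by linarith)

/-! ### Fourier coefficients of vector-valued functions on the circle -/

section Fourier

open AddCircle MeasureTheory
open scoped Real

variable {E E' : Type*} [NormedAddCommGroup E] [NormedSpace ℂ E]
  [NormedAddCommGroup E'] [NormedSpace ℂ E']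

instance fact_two_pi_pos : Fact (0 < 2 * π) := ⟨Real.two_pi_pos⟩

/-- The `k`-th Fourier coefficient of a continuous function on the unit circle of `ℂ`. -/
noncomputable def circleCoeff (g : C(Circle, E)) (k : ℤ) : E :=
  fourierCoeff (fun t : AddCircle (2 * π) => g t.toCircle) k

lemma fourier_eq_zpow (k : ℤ) (t : AddCircle (2 * π)) :
    fourier k t = (t.toCircle : ℂ) ^ k := by
  rw [fourier_apply, toCircle_zsmul, Circle.coe_zpow]

lemma circleCoeff_eq_integral (g : C(Circle, E)) (k : ℤ) :
    circleCoeff g k =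
      ∫ t : AddCircle (2 * π), (t.toCircle : ℂ) ^ (-k) • g t.toCircle ∂haarAddCircle := by
  simp only [circleCoeff, fourierCoeff, fourier_eq_zpow]

lemma continuous_toCircle_zpow (k : ℤ) :
    Continuous fun t : AddCircle (2 * π) => (t.toCircle : ℂ) ^ k := by
  simp only [← fourier_eq_zpow]
  exact map_continuous _

lemma integrable_of_continuous {B : Type*} [NormedAddCommGroup B] {F : AddCircle (2 * π) → B} (hF : Continuous F) :
    Integrable F haarAddCircle :=
  hF.integrable_of_hasCompactSupport (HasCompactSupport.of_compactSpace F)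

lemma continuous_comp_toCircle {B : Type*} [TopologicalSpace B] (g : C(Circle, B)) :
    Continuous fun t : AddCircle (2 * π) => g t.toCircle :=
  g.continuous.comp continuous_toCircle

lemma integral_toCircle_zpow (k : ℤ) :
    ∫ t : AddCircle (2 * π), (t.toCircle : ℂ) ^ k ∂haarAddCircle = if k = 0 then 1 else 0 := by
  have h := congr_fun (fourierCoeff_fourier (T := 2 * π) 0) (-k)
  simp only [fourierCoeff, neg_neg, fourier_eq_zpow, zpow_zero, smul_eq_mul, mul_one] at h
  rw [h, Pi.single_apply]
  simp

lemma circleCoeff_sub (g h : C(Circle, E)) (k : ℤ) :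
    circleCoeff (g - h) k = circleCoeff g k - circleCoeff h k := by
  simp only [circleCoeff_eq_integral, ContinuousMap.sub_apply, smul_sub]
  exact integral_sub
    (integrable_of_continuous ((continuous_toCircle_zpow _).smul (continuous_comp_toCircle g)))
    (integrable_of_continuous ((continuous_toCircle_zpow _).smul (continuous_comp_toCircle h)))

lemma circleCoeff_sum {ι : Type*} (s : Finset ι) (g : ι → C(Circle, E)) (k : ℤ) :
    circleCoeff (∑ i ∈ s, g i) k = ∑ i ∈ s, circleCoeff (g i) k := by
  simp only [circleCoeff_eq_integral, ContinuousMap.sum_apply, Finset.smul_sum]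
  exact integral_finsetSum _ fun i _ =>
    integrable_of_continuous ((continuous_toCircle_zpow _).smul (continuous_comp_toCircle (g i)))

lemma circleCoeff_comp [CompleteSpace E] [CompleteSpace E'] (A : E →L[ℂ] E') (g : C(Circle, E))
    (k : ℤ) : circleCoeff ((A : C(E, E')).comp g) k = A (circleCoeff g k) := by
  simp only [circleCoeff_eq_integral]
  have h := ContinuousLinearMap.integral_comp_comm A (integrable_of_continuous
    ((continuous_toCircle_zpow (-k)).smul (continuous_comp_toCircle g)))
  refine Eq.trans (integral_congr_ae (Filter.Eventually.of_forall fun t => ?_)) h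
  exact (map_smul A _ _).symm

lemma norm_circleCoeff_le (g : C(Circle, E)) (k : ℤ) : ‖circleCoeff g k‖ ≤ ‖g‖ := by
  rw [circleCoeff_eq_integral]
  refine (norm_integral_le_of_norm_le_const (C := ‖g‖) (Filter.Eventually.of_forall fun t => ?_)).trans
    (by simp)
  rw [norm_smul, norm_zpow, Circle.norm_coe, one_zpow, one_mul]
  exact g.norm_coe_le_norm _

/-- The function `w ↦ w ^ j • x` on the circle. -/
noncomputable def circleMonomial (j : ℤ) (x : E) : C(Circle, E) where
  toFun w := (w : ℂ) ^ j • x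
  continuous_toFun := by
    have : Continuous fun w : Circle => ((w ^ j : Circle) : ℂ) :=
      continuous_induced_dom.comp (continuous_zpow j)
    simp only [Circle.coe_zpow] at this
    exact this.smul continuous_const

@[simp]
lemma circleMonomial_apply (j : ℤ) (x : E) (w : Circle) :
    circleMonomial j x w = (w : ℂ) ^ j • x := rfl

lemma norm_circleMonomial_le (j : ℤ) (x : E) : ‖circleMonomial j x‖ ≤ ‖x‖ := by
  refine (ContinuousMap.norm_le _ (norm_nonneg x)).2 fun w => ?_
  rw [circleMonomial_apply, norm_smul, norm_zpow, Circle.norm_coe, one_zpow, one_mul]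

lemma circleCoeff_circleMonomial [CompleteSpace E] (j k : ℤ) (x : E) :
    circleCoeff (circleMonomial j x) k = if j = k then x else 0 := by
  rw [circleCoeff_eq_integral]
  have : ∀ t : AddCircle (2 * π), (t.toCircle : ℂ) ^ (-k) • circleMonomial j x t.toCircle =
      (t.toCircle : ℂ) ^ (j - k) • x := fun t => by
    rw [circleMonomial_apply, smul_smul, ← zpow_add₀ (Circle.coe_ne_zero _)]
    congr 2
    ring
  simp only [this]
  rw [integral_smul_const, integral_toCircle_zpow]
  simp only [sub_eq_zero]
  split_ifs <;> simp

/-- A scalar continuous function whose Fourier coefficients have absolute sum at most `C` is bounded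
by `C`. -/
lemma norm_apply_le_of_sum_norm_circleCoeff_le (g : C(Circle, ℂ)) {C : ℝ}
    (h : ∀ t : Finset ℤ, ∑ k ∈ t, ‖circleCoeff g k‖ ≤ C) (w : Circle) : ‖g w‖ ≤ C := by
  obtain ⟨t, rfl⟩ : ∃ t : AddCircle (2 * π), t.toCircle = w :=
    ⟨homeomorphCircle'.symm w, by
      have := homeomorphCircle'.apply_symm_apply w
      revert this
      generalize homeomorphCircle'.symm w = s
      induction s using QuotientAddGroup.induction_on with | H x => ?_
      intro h
      rw [← h, homeomorphCircle'_apply_mk, toCircle_apply_mk]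
      congr 1
      field_simp⟩
  let G : C(AddCircle (2 * π), ℂ) := ⟨fun t => g t.toCircle, continuous_comp_toCircle g⟩
  have hs : Summable fun k => ‖fourierCoeff G k‖ :=
    summable_of_sum_le (fun _ => norm_nonneg _) h
  have hG := has_pointwise_sum_fourier_series_of_summable hs.of_norm t
  refine le_of_tendsto hG.norm (Filter.Eventually.of_forall fun s => ?_)
  refine (norm_sum_le _ _).trans (le_trans (Finset.sum_le_sum fun k _ => ?_) (h s))
  rw [fourier_eq_zpow, norm_smul, norm_zpow, Circle.norm_coe, one_zpow, mul_one]
  exact le_rfl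

/-- A continuous function with values in a Banach space all of whose finite sums
`∑ λ_k ĝ(k)`, `|λ_k| ≤ 1`, have norm at most `C` is bounded by `C`. -/
lemma norm_le_of_norm_sum_smul_circleCoeff_le [CompleteSpace E] (g : C(Circle, E)) {C : ℝ}
    (h : ∀ (t : Finset ℤ) (l : ℤ → ℂ), (∀ k, ‖l k‖ ≤ 1) →
      ‖∑ k ∈ t, l k • circleCoeff g k‖ ≤ C) : ‖g‖ ≤ C := by
  have hC : 0 ≤ C := (norm_nonneg _).trans (h ∅ 0 (by simp))
  refine (ContinuousMap.norm_le _ hC).2 fun w => ?_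
  obtain ⟨φ, hφ, hφw⟩ := exists_dual_vector'' ℂ (g w)
  have hn : ‖g w‖ = ‖(φ : C(E, ℂ)).comp g w‖ := by
    simp [hφw]
  rw [hn]
  refine norm_apply_le_of_sum_norm_circleCoeff_le _ (fun t => ?_) w
  refine sum_norm_le_of_forall_norm_sum_mul_le t _ _ fun l hl => ?_
  have : ∑ k ∈ t, l k * circleCoeff ((φ : C(E, ℂ)).comp g) k =
      φ (∑ k ∈ t, l k • circleCoeff g k) := by
    simp [circleCoeff_comp]
  rw [this]
  exact (φ.le_of_opNorm_le hφ _).trans ((one_mul _).trans_le (h t l hl))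

/-- A circle integral over `|z| = r` as a Fourier coefficient of the rescaled function. -/
lemma circleIntegral_zpow_smul_eq (r : ℝ) (hr : 0 < r) (F : ℂ → E) (g : C(Circle, E))
    (hF : ∀ w : Circle, F ((r : ℂ) * w) = g w) (k : ℤ) :
    (2 * (π : ℂ) * Complex.I)⁻¹ • (∮ z in C(0, r), z ^ (-k - 1) • F z) =
      (r : ℂ) ^ (-k) • circleCoeff g k := by
  have hr' : (r : ℂ) ≠ 0 := by exact_mod_cast hr.ne'
  have hpi : (π : ℂ) ≠ 0 := by exact_mod_cast Real.pi_ne_zero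
  rw [circleCoeff, fourierCoeff_eq_intervalIntegral _ k 0, zero_add, circleIntegral]
  have h : ∀ x : ℝ, deriv (circleMap 0 r) x • (circleMap 0 r x) ^ (-k - 1) • F (circleMap 0 r x) =
      (Complex.I * (r : ℂ) ^ (-k)) • (fourier (-k) (x : AddCircle (2 * π)) •
        g (toCircle (x : AddCircle (2 * π)))) := fun x => by
    have e1 : circleMap 0 r x = (r : ℂ) * (toCircle (x : AddCircle (2 * π)) : ℂ) := by
      rw [toCircle_apply_mk, circleMap_zero, Circle.coe_exp]
      congr 3
      have : (2 * π / (2 * π)) * x = x := by field_simp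
      rw [this]
    have e2 : (toCircle (x : AddCircle (2 * π)) : ℂ) ≠ 0 := Circle.coe_ne_zero _
    rw [deriv_circleMap, fourier_eq_zpow, e1, hF, smul_smul, smul_smul]
    congr 1
    rw [mul_zpow, zpow_sub₀ hr', zpow_sub₀ e2]
    field_simp
  simp only [h]
  rw [intervalIntegral.integral_smul, smul_smul]
  rw [← Complex.coe_smul, smul_smul]
  congr 1
  push_cast
  field_simp

end Fourier

/-! ### Fejér means -/

section Fejer

open AddCircle MeasureTheory
open scoped Real

variable {E : Type*} [NormedAddCommGroup E] [NormedSpace ℂ E]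

/-- The Fejér mean `∑_{|k| < N} (1 - |k| / N) ĝ(k) w ^ k`, written as
`N⁻¹ ∑_{i, j < N} ĝ(i - j) w ^ (i - j)`, from which the positivity of the kernel is visible. -/
noncomputable def fejerMean (g : C(Circle, E)) (N : ℕ) : C(Circle, E) :=
  ∑ p ∈ Finset.range N ×ˢ Finset.range N,
    circleMonomial ((p.1 : ℤ) - p.2) ((N : ℂ)⁻¹ • circleCoeff g ((p.1 : ℤ) - p.2))

/-- The multiplier `max (1 - |k| / N) 0` of the Fejér mean, as `N⁻¹` times the number of pairs
`(i, j)` with `i, j < N` and `i - j = k`. -/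
noncomputable def fejerWeight (N : ℕ) (k : ℤ) : ℝ :=
  ((Finset.range N ×ˢ Finset.range N).filter fun p : ℕ × ℕ => (p.1 : ℤ) - p.2 = k).card / N

lemma fejerWeight_nonneg (N : ℕ) (k : ℤ) : 0 ≤ fejerWeight N k := by
  unfold fejerWeight; positivity

lemma fejerWeight_le_one (N : ℕ) (k : ℤ) : fejerWeight N k ≤ 1 := by
  refine div_le_one_of_le₀ ?_ (Nat.cast_nonneg N)
  have : ((Finset.range N ×ˢ Finset.range N).filter
      fun p : ℕ × ℕ => (p.1 : ℤ) - p.2 = k).card ≤ (Finset.range N).card := by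
    refine Finset.card_le_card_of_injOn Prod.snd (fun p hp => ?_) fun p hp q hq h => ?_
    · simp only [Finset.coe_filter, Finset.mem_product, mem_ofPred_eq] at hp
      exact hp.1.2
    · simp only [Finset.coe_filter, mem_ofPred_eq] at hp hq
      exact Prod.ext (by omega) h
  rw [Finset.card_range] at this
  exact_mod_cast this

lemma one_sub_fejerWeight_le {N : ℕ} (hN : 0 < N) (k : ℤ) :
    1 - fejerWeight N k ≤ |(k : ℝ)| / N := by
  have hN' : (0 : ℝ) < N := by exact_mod_cast hN
  have h : N - k.natAbs ≤ ((Finset.range N ×ˢ Finset.range N).filter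
      fun p : ℕ × ℕ => (p.1 : ℤ) - p.2 = k).card := by
    rw [← Finset.card_range (N - k.natAbs)]
    refine Finset.card_le_card_of_injOn (fun l => (l + k.toNat, l + (-k).toNat))
      (fun l hl => ?_) fun l _ l' _ h => ?_
    · simp only [Finset.coe_range, mem_Iio] at hl
      simp only [Finset.coe_filter, Finset.mem_product, Finset.mem_range, mem_ofPred_eq]
      omega
    · simp only [Prod.mk.injEq] at h
      omega
  have h' : (N : ℝ) ≤ (((Finset.range N ×ˢ Finset.range N).filter
      fun p : ℕ × ℕ => (p.1 : ℤ) - p.2 = k).card : ℝ) + |(k : ℝ)| := by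
    have e : |(k : ℝ)| = (k.natAbs : ℝ) := by
      rw [Nat.cast_natAbs, Int.cast_abs]
    rw [e, ← Nat.cast_add, Nat.cast_le]
    omega
  rw [fejerWeight, sub_le_iff_le_add, ← add_div, one_le_div hN']
  linarith

lemma circleCoeff_fejerMean [CompleteSpace E] (g : C(Circle, E)) (N : ℕ) (k : ℤ) :
    circleCoeff (fejerMean g N) k = (fejerWeight N k : ℂ) • circleCoeff g k := by
  rw [fejerMean, circleCoeff_sum]
  simp only [circleCoeff_circleMonomial]
  rw [← Finset.sum_filter, Finset.sum_congr rfl (g := fun _ => (N : ℂ)⁻¹ • circleCoeff g k)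
    fun p hp => by rw [(Finset.mem_filter.1 hp).2]]
  rw [Finset.sum_const, ← Nat.cast_smul_eq_nsmul ℂ, smul_smul, fejerWeight]
  push_cast
  rw [div_eq_mul_inv]

/-- Fejér means do not increase the maximum norm, because the Fejér kernel is positive and has
integral one. -/
lemma norm_fejerMean_le [CompleteSpace E] (g : C(Circle, E)) {N : ℕ} (hN : 0 < N) :
    ‖fejerMean g N‖ ≤ ‖g‖ := by
  have hN' : (N : ℂ) ≠ 0 := by exact_mod_cast hN.ne'
  refine (ContinuousMap.norm_le _ (norm_nonneg g)).2 fun w => ?_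
  let S := Finset.range N ×ˢ Finset.range N
  -- the Fejér kernel
  let K : AddCircle (2 * π) → ℂ := fun t =>
    ∑ p ∈ S, (N : ℂ)⁻¹ * ((w : ℂ) ^ ((p.1 : ℤ) - p.2) * (t.toCircle : ℂ) ^ (-((p.1 : ℤ) - p.2)))
  have hterm : ∀ p : ℕ × ℕ, Continuous fun t : AddCircle (2 * π) => (N : ℂ)⁻¹ *
      ((w : ℂ) ^ ((p.1 : ℤ) - p.2) * (t.toCircle : ℂ) ^ (-((p.1 : ℤ) - p.2))) := fun p =>
    continuous_const.mul (continuous_const.mul (continuous_toCircle_zpow _))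
  have hKc : Continuous K := continuous_finsetSum _ fun p _ => hterm p
  have hmean : fejerMean g N w = ∫ t, K t • g t.toCircle ∂haarAddCircle := by
    simp only [K, Finset.sum_smul]
    refine Eq.trans ?_ (integral_finsetSum _ fun p _ =>
      integrable_of_continuous ((hterm p).smul (continuous_comp_toCircle g))).symm
    rw [fejerMean, ContinuousMap.sum_apply]
    refine Finset.sum_congr rfl fun p _ => ?_
    rw [circleMonomial_apply, smul_smul, circleCoeff_eq_integral, ← integral_smul]
    refine integral_congr_ae (Filter.Eventually.of_forall fun t => ?_)
    simp only [smul_smul]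
    congr 1
    ring
  have hKpos : ∀ t, ((‖K t‖ : ℝ) : ℂ) = K t := fun t => by
    let a : ℂ := ∑ j ∈ Finset.range N, ((w : ℂ) * (t.toCircle : ℂ)⁻¹) ^ (j : ℤ)
    have hconj : (starRingEnd ℂ) ((w : ℂ) * (t.toCircle : ℂ)⁻¹) =
        ((w : ℂ) * (t.toCircle : ℂ)⁻¹)⁻¹ := by
      rw [← Circle.coe_inv, ← Circle.coe_mul, ← Circle.coe_inv_eq_conj, Circle.coe_inv]
    have hne : (w : ℂ) * (t.toCircle : ℂ)⁻¹ ≠ 0 :=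
      mul_ne_zero (Circle.coe_ne_zero _) (inv_ne_zero (Circle.coe_ne_zero _))
    have hK : K t = (((N : ℝ)⁻¹ * ‖a‖ ^ 2 : ℝ) : ℂ) := by
      have : ((‖a‖ ^ 2 : ℝ) : ℂ) = a * (starRingEnd ℂ) a := by
        rw [Complex.mul_conj']; push_cast; rfl
      rw [Complex.ofReal_mul, this]
      simp only [a, map_sum, map_zpow₀, hconj, K, S]
      rw [Finset.sum_mul_sum, ← Finset.sum_product', Finset.mul_sum]
      refine Finset.sum_congr rfl fun p _ => ?_
      push_cast
      congr 1
      rw [inv_zpow', ← zpow_add₀ hne, mul_zpow, inv_zpow', ← sub_eq_add_neg]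
    rw [hK, Complex.norm_real, Real.norm_of_nonneg (by positivity)]
  have hKint : ∫ t, K t ∂haarAddCircle = 1 := by
    simp only [K]
    rw [integral_finsetSum _ fun p _ => integrable_of_continuous (hterm p)]
    simp only [integral_const_mul, integral_toCircle_zpow]
    have : ∀ p ∈ S, (N : ℂ)⁻¹ * ((w : ℂ) ^ ((p.1 : ℤ) - p.2) *
        if -((p.1 : ℤ) - p.2) = 0 then 1 else 0) = if p.1 = p.2 then (N : ℂ)⁻¹ else 0 := by
      intro p _
      by_cases h : p.1 = p.2
      · simp [h]
      · rw [if_neg (by omega), if_neg h, mul_zero, mul_zero]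
    rw [Finset.sum_congr rfl this, Finset.sum_product]
    simp only [Finset.sum_ite_eq, Finset.mem_range]
    rw [Finset.sum_congr rfl fun i hi => if_pos (Finset.mem_range.1 hi)]
    simp [hN']
  rw [hmean]
  have h1 : ‖∫ t, K t • g t.toCircle ∂haarAddCircle‖ ≤
      ∫ t, ‖K t‖ * ‖g‖ ∂(haarAddCircle : Measure (AddCircle (2 * π))) := by
    refine norm_integral_le_of_norm_le
      (integrable_of_continuous (hKc.norm.mul continuous_const))
      (Filter.Eventually.of_forall fun t => ?_)
    rw [norm_smul]
    exact mul_le_mul_of_nonneg_left (g.norm_coe_le_norm _) (norm_nonneg _)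
  refine h1.trans_eq ?_
  rw [integral_mul_const]
  have h2 : ∫ t, ‖K t‖ ∂(haarAddCircle : Measure (AddCircle (2 * π))) = 1 := by
    have : ((∫ t, ‖K t‖ ∂(haarAddCircle : Measure (AddCircle (2 * π))) : ℝ) : ℂ) = 1 := by
      rw [← integral_complex_ofReal]
      simp only [hKpos, hKint]
    exact_mod_cast this
  rw [h2, one_mul]

end Fejer

/-! ### The space `X₀ + X₁` and functions in `𝓕(X)` -/

namespace BanachCouple

section Couple

variable {X₀ X₁ V : Type*}
  [NormedAddCommGroup X₀] [NormedSpace ℂ X₀] [CompleteSpace X₀]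
  [NormedAddCommGroup X₁] [NormedSpace ℂ X₁] [CompleteSpace X₁]
  [AddCommGroup V] [Module ℂ V] [TopologicalSpace V] [IsTopologicalAddGroup V]
  [ContinuousSMul ℂ V] [T2Space V]
  (X : BanachCouple X₀ X₁ V)

lemma norm_incl₀_le (x : X₀) : ‖X.incl₀ x‖ ≤ ‖x‖ :=
  (X.norm_mkSum_le _).trans_eq (by simp)

lemma norm_incl₁_le (x : X₁) : ‖X.incl₁ x‖ ≤ ‖x‖ :=
  (X.norm_mkSum_le _).trans_eq (by simp)

/-- The inclusion `X₀ ⊆ X₀ + X₁` as a continuous linear map. -/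
noncomputable def inclL₀ : X₀ →L[ℂ] X.SumSpace :=
  X.incl₀.mkContinuous 1 fun x => (X.norm_incl₀_le x).trans_eq (one_mul _).symm

/-- The inclusion `X₁ ⊆ X₀ + X₁` as a continuous linear map. -/
noncomputable def inclL₁ : X₁ →L[ℂ] X.SumSpace :=
  X.incl₁.mkContinuous 1 fun x => (X.norm_incl₁_le x).trans_eq (one_mul _).symm

@[simp] lemma inclL₀_apply (x : X₀) : X.inclL₀ x = X.incl₀ x := rfl

@[simp] lemma inclL₁_apply (x : X₁) : X.inclL₁ x = X.incl₁ x := rfl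

lemma mkSum_eq_add (p : WithLp 1 (X₀ × X₁)) :
    X.mkSum p = X.incl₀ p.fst + X.incl₁ p.snd := by
  change _ = X.mkSum _ + X.mkSum _
  rw [← map_add, ← WithLp.toLp_add, Prod.mk_add_mk, add_zero, zero_add]
  rfl

lemma isQuotientMap_mkSum : Topology.IsQuotientMap X.mkSum :=
  X.sumKer.isOpenQuotientMap_mkQ.isQuotientMap

lemma isOpen_openAnnulus : IsOpen openAnnulus :=
  (isOpen_lt continuous_const continuous_norm).inter
    (isOpen_lt continuous_norm continuous_const)

lemma openAnnulus_subset_closedAnnulus : openAnnulus ⊆ closedAnnulus :=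
  fun _ hz => ⟨hz.1.le, hz.2.le⟩

lemma ofReal_exp_intCast (k : ℤ) : (Real.exp k : ℂ) = (Real.exp 1 : ℂ) ^ k := by
  rw [Complex.ofReal_exp, Complex.ofReal_exp, ← Complex.exp_int_mul]
  simp

lemma ne_zero_of_mem_closedAnnulus {z : ℂ} (hz : z ∈ closedAnnulus) : z ≠ 0 :=
  norm_pos_iff.1 (one_pos.trans_le hz.1)

lemma continuousOn_zpow_closedAnnulus (k : ℤ) : ContinuousOn (fun z : ℂ => z ^ k) closedAnnulus :=
  fun z hz => (continuousAt_zpow₀ z k (Or.inl (ne_zero_of_mem_closedAnnulus hz))).continuousWithinAt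

lemma differentiableOn_zpow_openAnnulus (k : ℤ) :
    DifferentiableOn ℂ (fun z : ℂ => z ^ k) openAnnulus := fun _ hz =>
  (differentiableAt_zpow.2 (Or.inl (ne_zero_of_mem_closedAnnulus
    (openAnnulus_subset_closedAnnulus hz)))).differentiableWithinAt

namespace CalderonFun

variable {X}

lemma coeff_eq_incl₀ (f : X.CalderonFun) (k : ℤ) :
    f.coeff k = X.incl₀ (circleCoeff f.bdry₀ k) := by
  have h := circleIntegral_zpow_smul_eq 1 one_pos f.toFun ((X.inclL₀ : C(X₀, X.SumSpace)).comp f.bdry₀)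
    (fun w => by
      rw [Complex.ofReal_one, one_mul, f.eq_bdry₀]
      rfl) k
  rw [circleCoeff_comp, Complex.ofReal_one, one_zpow, one_smul] at h
  exact h

/-- By Cauchy's theorem the coefficients can be computed on the outer circle as well. -/
lemma exp_smul_coeff_eq_incl₁ (f : X.CalderonFun) (k : ℤ) :
    (Real.exp k : ℂ) • f.coeff k = X.incl₁ (circleCoeff f.bdry₁ k) := by
  have h := circleIntegral_zpow_smul_eq (Real.exp 1) (Real.exp_pos 1) f.toFun
    ((X.inclL₁ : C(X₁, X.SumSpace)).comp f.bdry₁) (fun w => by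
      rw [f.eq_bdry₁]
      rfl) k
  have hC : (∮ z in C(0, Real.exp 1), z ^ (-k - 1) • f.toFun z) =
      ∮ z in C(0, 1), z ^ (-k - 1) • f.toFun z := by
    refine Complex.circleIntegral_eq_of_differentiable_on_annulus_off_countable one_pos
      (Real.one_le_exp zero_le_one) countable_empty ?_ ?_
    · refine ((continuousOn_zpow_closedAnnulus _).smul f.continuousOn).mono fun z hz => ?_
      simp only [mem_sdiff, mem_closedBall_zero_iff, mem_ball_zero_iff, not_lt] at hz
      exact ⟨hz.2, hz.1⟩
    · intro z hz
      simp only [sdiff_empty, mem_sdiff, mem_closedBall_zero_iff, mem_ball_zero_iff, not_le] at hz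
      exact ((differentiableOn_zpow_openAnnulus _).smul f.differentiableOn).differentiableAt
        (isOpen_openAnnulus.mem_nhds ⟨hz.2, hz.1⟩)
  rw [hC, circleCoeff_comp] at h
  have he0 : (Real.exp 1 : ℂ) ≠ 0 := by exact_mod_cast (Real.exp_pos 1).ne'
  have h' : f.coeff k = (Real.exp 1 : ℂ) ^ (-k) • X.incl₁ (circleCoeff f.bdry₁ k) := h
  rw [h', ofReal_exp_intCast, smul_smul, ← zpow_add₀ he0]
  simp

/-- A finite sum of functions in `𝓕(X)`. -/
noncomputable def finsetSum {ι : Type*} (t : Finset ι) (F : ι → X.CalderonFun) : X.CalderonFun where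
  toFun z := ∑ i ∈ t, (F i).toFun z
  bdry₀ := ∑ i ∈ t, (F i).bdry₀
  bdry₁ := ∑ i ∈ t, (F i).bdry₁
  continuousOn := continuousOn_finsetSum _ fun i _ => (F i).continuousOn
  differentiableOn := DifferentiableOn.fun_sum fun i _ => (F i).differentiableOn
  eq_bdry₀ w := by
    rw [ContinuousMap.sum_apply, map_sum]
    exact Finset.sum_congr rfl fun i _ => (F i).eq_bdry₀ w
  eq_bdry₁ w := by
    rw [ContinuousMap.sum_apply, map_sum]
    exact Finset.sum_congr rfl fun i _ => (F i).eq_bdry₁ w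

/-- The function `z ↦ z ^ k • x` for an element `x` of `X₀ ∩ X₁`, which is given by its two
incarnations `x₀ ∈ X₀` and `x₁ ∈ X₁`. -/
noncomputable def monomial (k : ℤ) (x₀ : X₀) (x₁ : X₁) (h : X.incl₀ x₀ = X.incl₁ x₁) :
    X.CalderonFun where
  toFun z := z ^ k • X.incl₀ x₀
  bdry₀ := circleMonomial k x₀
  bdry₁ := circleMonomial k ((Real.exp k : ℂ) • x₁)
  continuousOn := (continuousOn_zpow_closedAnnulus k).smul (continuousOn_const (c := X.incl₀ x₀))
  differentiableOn := (differentiableOn_zpow_openAnnulus k).smul_const _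
  eq_bdry₀ w := by rw [circleMonomial_apply, map_smul]
  eq_bdry₁ w := by
    rw [circleMonomial_apply, map_smul, map_smul, h, smul_smul, mul_zpow,
      ← ofReal_exp_intCast, mul_comm]

/-- The product of `z ^ k` and a function in `𝓕(X)`. -/
noncomputable def zpowMul (k : ℤ) (f : X.CalderonFun) : X.CalderonFun where
  toFun z := z ^ k • f.toFun z
  bdry₀ := circleMonomial k (1 : ℂ) • f.bdry₀
  bdry₁ := circleMonomial k (Real.exp k : ℂ) • f.bdry₁
  continuousOn := (continuousOn_zpow_closedAnnulus k).smul f.continuousOn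
  differentiableOn := (differentiableOn_zpow_openAnnulus k).smul f.differentiableOn
  eq_bdry₀ w := by
    rw [ContinuousMap.smul_apply', map_smul, circleMonomial_apply, smul_eq_mul, mul_one, f.eq_bdry₀]
  eq_bdry₁ w := by
    rw [ContinuousMap.smul_apply', map_smul, circleMonomial_apply, smul_eq_mul, f.eq_bdry₁, mul_zpow,
      ← ofReal_exp_intCast, mul_comm]

lemma norm_bdry₀_zpowMul_le (k : ℤ) (f : X.CalderonFun) : ‖(f.zpowMul k).bdry₀‖ ≤ ‖f.bdry₀‖ := by
  refine (ContinuousMap.norm_le _ (norm_nonneg _)).2 fun w => ?_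
  change ‖circleMonomial k (1 : ℂ) w • f.bdry₀ w‖ ≤ _
  rw [circleMonomial_apply, smul_eq_mul, mul_one, norm_smul, norm_zpow, Circle.norm_coe, one_zpow,
    one_mul]
  exact f.bdry₀.norm_coe_le_norm w

lemma norm_bdry₁_zpowMul_le (k : ℤ) (f : X.CalderonFun) :
    ‖(f.zpowMul k).bdry₁‖ ≤ Real.exp k * ‖f.bdry₁‖ := by
  refine (ContinuousMap.norm_le _ (by positivity)).2 fun w => ?_
  change ‖circleMonomial k (Real.exp k : ℂ) w • f.bdry₁ w‖ ≤ _
  rw [circleMonomial_apply, smul_eq_mul, norm_smul, norm_mul, norm_zpow, Circle.norm_coe, one_zpow,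
    one_mul, Complex.norm_real, Real.norm_of_nonneg (Real.exp_pos _).le]
  exact mul_le_mul_of_nonneg_left (f.bdry₁.norm_coe_le_norm w) (Real.exp_pos _).le

/-- The value `f(e^θ)` as an element of `X_θ`. -/
noncomputable def value (θ : unitInterval) (f : X.CalderonFun) : X.Interp θ :=
  (⟨f.toFun (expPt θ), f, rfl⟩ : X.interpSubmodule θ)

@[simp]
lemma toSum_value (θ : unitInterval) (f : X.CalderonFun) :
    Interp.toSum (f.value θ) = f.toFun (expPt θ) := rfl

/-- An absolutely convergent series in `𝓕(X)` has a sum in `𝓕(X)`. -/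
lemma exists_tsum (F : ℕ → X.CalderonFun) (b : ℕ → ℝ) (hb : Summable b)
    (hF : ∀ n, (F n).calNorm ≤ b n) :
    ∃ S : X.CalderonFun, (∀ z, S.toFun z = ∑' n, (F n).toFun z) ∧ S.calNorm ≤ ∑' n, b n := by
  have h0 : ∀ n, ‖(F n).bdry₀‖ ≤ b n := fun n => (le_max_left _ _).trans (hF n)
  have h1 : ∀ n, ‖(F n).bdry₁‖ ≤ b n := fun n => (le_max_right _ _).trans (hF n)
  have s0 : Summable fun n => (F n).bdry₀ := Summable.of_norm_bounded hb h0
  have s1 : Summable fun n => (F n).bdry₁ := Summable.of_norm_bounded hb h1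
  refine ⟨{
    toFun := fun z => ∑' n, (F n).toFun z
    bdry₀ := ∑' n, (F n).bdry₀
    bdry₁ := ∑' n, (F n).bdry₁
    continuousOn := continuousOn_tsum (fun n => (F n).continuousOn) hb
      fun n z hz => ((F n).norm_toFun_le hz).trans (hF n)
    differentiableOn := Complex.differentiableOn_tsum_of_summable_norm hb
      (fun n => (F n).differentiableOn) isOpen_openAnnulus
      fun n z hz => ((F n).norm_toFun_le (openAnnulus_subset_closedAnnulus hz)).trans (hF n)
    eq_bdry₀ := fun w => by
      have := (X.inclL₀.comp (ContinuousMap.evalCLM ℂ w)).map_tsum s0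
      refine Eq.trans ?_ this.symm
      exact tsum_congr fun n => (F n).eq_bdry₀ w
    eq_bdry₁ := fun w => by
      have := (X.inclL₁.comp (ContinuousMap.evalCLM ℂ w)).map_tsum s1
      refine Eq.trans ?_ this.symm
      exact tsum_congr fun n => (F n).eq_bdry₁ w }, fun z => rfl, max_le ?_ ?_⟩
  · exact tsum_of_norm_bounded hb.hasSum h0
  · exact tsum_of_norm_bounded hb.hasSum h1

end CalderonFun

/-! ### The space `X_θ` -/

namespace Interp

variable {X} {θ : unitInterval}

/-- Elements of `X₀ ∩ X₁` lie in `X_θ`, with norm at most the larger of the two norms. -/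
lemma norm_le_max (x : X.Interp θ) (x₀ : X₀) (x₁ : X₁) (h₀ : toSum x = X.incl₀ x₀)
    (h₁ : X.incl₀ x₀ = X.incl₁ x₁) : ‖x‖ ≤ max ‖x₀‖ ‖x₁‖ := by
  refine (norm_le x (CalderonFun.monomial 0 x₀ x₁ h₁) ?_).trans (max_le_max ?_ ?_)
  · rw [h₀]; simp [CalderonFun.monomial]
  · exact norm_circleMonomial_le _ _
  · exact (norm_circleMonomial_le _ _).trans_eq (by simp)

/-- A function in `𝓕(X)` which is bounded on the outer circle and small on the inner one has a small
value in `X_θ`. This is the substitute for `‖f(e^θ)‖ ≤ ‖f‖₀ ^ (1 - θ) ‖f‖₁ ^ θ` on the annulus, where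
only integral powers of `z` are at hand to balance the two circles. -/
lemma exists_norm_value_le (hθ₁ : (θ : ℝ) < 1) (B : ℝ) {η : ℝ} (hη : 0 < η) :
    ∃ δ > 0, ∀ (X : BanachCouple X₀ X₁ V) (f : X.CalderonFun), ‖f.bdry₀‖ ≤ δ → ‖f.bdry₁‖ ≤ B →
      ‖f.value θ‖ ≤ η := by
  have hlim : Filter.Tendsto (fun m : ℕ => Real.exp (-((m : ℝ) * (1 - θ))) * B) Filter.atTop
      (nhds 0) := by
    rw [← zero_mul B]
    refine Filter.Tendsto.mul_const B (Real.tendsto_exp_neg_atTop_nhds_zero.comp ?_)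
    exact tendsto_natCast_atTop_atTop.atTop_mul_const (by linarith)
  obtain ⟨m, hm⟩ := (hlim.eventually (gt_mem_nhds hη)).exists
  refine ⟨η * Real.exp (-((m : ℝ) * θ)), by positivity, fun X f h0 h1 => ?_⟩
  let c : ℂ := (Real.exp ((m : ℝ) * θ) : ℂ)
  have hc : ‖c‖ = Real.exp ((m : ℝ) * θ) := by
    rw [Complex.norm_real, Real.norm_of_nonneg (Real.exp_pos _).le]
  refine (norm_le _ ((f.zpowMul (-(m : ℤ))).smul c) ?_).trans ?_
  · change c • (expPt θ ^ (-(m : ℤ)) • f.toFun (expPt θ)) = f.toFun (expPt θ)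
    have : c * expPt θ ^ (-(m : ℤ)) = 1 := by
      have hne : Real.exp (θ : ℝ) ^ m ≠ 0 := pow_ne_zero _ (Real.exp_pos _).ne'
      rw [expPt, zpow_neg, zpow_natCast]
      simp only [c]
      rw [Real.exp_nat_mul, ← Complex.ofReal_pow, ← Complex.ofReal_inv, ← Complex.ofReal_mul,
        mul_inv_cancel₀ hne, Complex.ofReal_one]
    rw [smul_smul, this, one_smul]
  · rw [CalderonFun.calNorm_smul, hc, CalderonFun.calNorm, mul_max_of_nonneg _ _ (Real.exp_pos _).le]
    refine max_le ?_ ?_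
    · calc Real.exp ((m : ℝ) * θ) * ‖(f.zpowMul (-(m : ℤ))).bdry₀‖
          ≤ Real.exp ((m : ℝ) * θ) * (η * Real.exp (-((m : ℝ) * θ))) := by
            gcongr
            exact (f.norm_bdry₀_zpowMul_le _).trans h0
        _ = η := by
            rw [mul_left_comm, ← Real.exp_add, add_neg_cancel, Real.exp_zero, mul_one]
    · calc Real.exp ((m : ℝ) * θ) * ‖(f.zpowMul (-(m : ℤ))).bdry₁‖
          ≤ Real.exp ((m : ℝ) * θ) * (Real.exp ((-(m : ℤ) : ℤ) : ℝ) * B) := by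
            gcongr
            exact (f.norm_bdry₁_zpowMul_le _).trans
              (mul_le_mul_of_nonneg_left h1 (Real.exp_pos _).le)
        _ = Real.exp (-((m : ℝ) * (1 - θ))) * B := by
            rw [← mul_assoc, ← Real.exp_add]
            congr 2
            push_cast
            ring
        _ ≤ η := hm.le

lemma exists_value_eq_calNorm_lt (x : X.Interp θ) {ε : ℝ} (hε : 0 < ε) :
    ∃ f : X.CalderonFun, f.toFun (expPt θ) = toSum x ∧ f.calNorm < ‖x‖ + ε := by
  obtain ⟨f, hf⟩ := x.2
  have : Nonempty {f : X.CalderonFun // f.toFun (expPt θ) = toSum x} := ⟨⟨f, hf⟩⟩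
  obtain ⟨g, hg⟩ := exists_lt_of_ciInf_lt (show (⨅ f : {f : X.CalderonFun //
    f.toFun (expPt θ) = toSum x}, f.1.calNorm) < ‖x‖ + ε from lt_add_of_pos_right ‖x‖ hε)
  exact ⟨g.1, g.2, hg⟩

instance : CompleteSpace (X.Interp θ) := by
  refine NormedAddCommGroup.completeSpace_of_summable_imp_tendsto fun u hu => ?_
  choose F hFu hF using fun n => exists_value_eq_calNorm_lt (u n) (ε := (1 / 2 : ℝ) ^ n)
    (by positivity)
  set b : ℕ → ℝ := fun n => ‖u n‖ + (1 / 2 : ℝ) ^ n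
  have hb : Summable b := hu.add summable_geometric_two
  obtain ⟨S, hS, -⟩ := CalderonFun.exists_tsum F b hb fun n => (hF n).le
  have hs : Summable fun n => (F n).toFun (expPt θ) :=
    Summable.of_norm_bounded hb fun n => ((F n).norm_toFun_le (expPt_mem θ)).trans (hF n).le
  refine ⟨S.value θ, ?_⟩
  rw [tendsto_iff_norm_sub_tendsto_zero]
  refine squeeze_zero (fun n => norm_nonneg _) (fun n => ?_) (tendsto_sum_nat_add b)
  obtain ⟨R, hR, hRb⟩ := CalderonFun.exists_tsum (fun k => F (k + n)) (fun k => b (k + n))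
    ((summable_nat_add_iff n).2 hb) fun k => (hF _).le
  rw [norm_sub_rev]
  refine (norm_le _ R ?_).trans hRb
  rw [hR, map_sub, map_sum, CalderonFun.toSum_value, hS, ← hs.sum_add_tsum_nat_add n]
  simp only [hFu]
  abel

end Interp

end Couple

/-! ### Operators between couples -/

namespace Hom

variable {X₀ X₁ V Y₀ Y₁ W : Type*}
  [NormedAddCommGroup X₀] [NormedSpace ℂ X₀] [CompleteSpace X₀]
  [NormedAddCommGroup X₁] [NormedSpace ℂ X₁] [CompleteSpace X₁]
  [AddCommGroup V] [Module ℂ V] [TopologicalSpace V] [IsTopologicalAddGroup V]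
  [ContinuousSMul ℂ V] [T2Space V]
  [NormedAddCommGroup Y₀] [NormedSpace ℂ Y₀] [CompleteSpace Y₀]
  [NormedAddCommGroup Y₁] [NormedSpace ℂ Y₁] [CompleteSpace Y₁]
  [AddCommGroup W] [Module ℂ W] [TopologicalSpace W] [IsTopologicalAddGroup W]
  [ContinuousSMul ℂ W] [T2Space W]
  {X : BanachCouple X₀ X₁ V} {Y : BanachCouple Y₀ Y₁ W}

lemma continuous_map (T : Hom X Y) : Continuous T.map := by
  rw [X.isQuotientMap_mkSum.continuous_iff]
  have h : T.map ∘ X.mkSum = fun p => Y.inclL₀ (T.map₀ p.fst) + Y.inclL₁ (T.map₁ p.snd) := by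
    funext p
    rw [Function.comp_apply, mkSum_eq_add, map_add, T.map_incl₀, T.map_incl₁]
    rfl
  rw [h]
  have hc := (WithLp.prodContinuousLinearEquiv 1 ℂ X₀ X₁).continuous
  exact ((Y.inclL₀.continuous.comp T.map₀.continuous).comp (continuous_fst.comp hc)).add
    ((Y.inclL₁.continuous.comp T.map₁.continuous).comp (continuous_snd.comp hc))

/-- The operator on `X₀ + X₁` as a continuous linear map. -/
def mapL (T : Hom X Y) : X.SumSpace →L[ℂ] Y.SumSpace := ⟨T.map, T.continuous_map⟩

/-- The composition `T ∘ f` of an operator with a function in `𝓕(X)`. -/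
noncomputable def compFun (T : Hom X Y) (f : X.CalderonFun) : Y.CalderonFun where
  toFun z := T.mapL (f.toFun z)
  bdry₀ := (T.map₀ : C(X₀, Y₀)).comp f.bdry₀
  bdry₁ := (T.map₁ : C(X₁, Y₁)).comp f.bdry₁
  continuousOn := T.mapL.continuous.comp_continuousOn f.continuousOn
  differentiableOn := T.mapL.differentiable.comp_differentiableOn f.differentiableOn
  eq_bdry₀ w := by
    rw [f.eq_bdry₀]
    exact T.map_incl₀ _
  eq_bdry₁ w := by
    rw [f.eq_bdry₁]
    exact T.map_incl₁ _

end Hom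

end BanachCouple

/-! ### Fejér means of functions in `𝓕(X)` -/

/-- The sums `∑ |k| e^{-|k| s}` over finite sets of integers are bounded, for every `s > 0`. -/
lemma exists_sum_abs_mul_exp_neg_le {s : ℝ} (hs : 0 < s) :
    ∃ S : ℝ, ∀ t : Finset ℤ, ∑ k ∈ t, |(k : ℝ)| * Real.exp (-(|(k : ℝ)| * s)) ≤ S := by
  have h : Summable fun n : ℕ => (n : ℝ) * Real.exp (-((n : ℝ) * s)) := by
    have := Real.summable_pow_mul_exp_neg_nat_mul 1 hs
    refine this.congr fun n => ?_
    rw [pow_one]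
    congr 2
    ring
  have hZ : Summable fun k : ℤ => |(k : ℝ)| * Real.exp (-(|(k : ℝ)| * s)) := by
    refine Summable.of_nat_of_neg ?_ ?_
    · simpa using h
    · simpa using h
  exact ⟨_, fun t => hZ.sum_le_tsum t fun k _ => by positivity⟩

namespace BanachCouple

variable {X₀ X₁ V : Type*}
  [NormedAddCommGroup X₀] [NormedSpace ℂ X₀] [CompleteSpace X₀]
  [NormedAddCommGroup X₁] [NormedSpace ℂ X₁] [CompleteSpace X₁]
  [AddCommGroup V] [Module ℂ V] [TopologicalSpace V] [IsTopologicalAddGroup V]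
  [ContinuousSMul ℂ V] [T2Space V]
  {X : BanachCouple X₀ X₁ V}

namespace CalderonFun

/-- The coefficient `f̂(k)` as an element of `X₁`. -/
noncomputable def coeff₁ (f : X.CalderonFun) (k : ℤ) : X₁ :=
  (Real.exp (-(k : ℝ)) : ℂ) • circleCoeff f.bdry₁ k

lemma exp_smul_coeff₁ (f : X.CalderonFun) (k : ℤ) :
    (Real.exp (k : ℝ) : ℂ) • f.coeff₁ k = circleCoeff f.bdry₁ k := by
  rw [coeff₁, smul_smul, ← Complex.ofReal_mul, ← Real.exp_add]
  simp

lemma incl₀_circleCoeff_eq_incl₁ (f : X.CalderonFun) (k : ℤ) :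
    X.incl₀ (circleCoeff f.bdry₀ k) = X.incl₁ (f.coeff₁ k) := by
  rw [coeff₁, map_smul, ← exp_smul_coeff_eq_incl₁, smul_smul, ← Complex.ofReal_mul,
    ← Real.exp_add, ← coeff_eq_incl₀]
  simp

lemma norm_coeff₁_le (f : X.CalderonFun) (k : ℤ) :
    ‖f.coeff₁ k‖ ≤ Real.exp (-(k : ℝ)) * ‖f.bdry₁‖ := by
  rw [coeff₁, norm_smul, Complex.norm_real, Real.norm_of_nonneg (Real.exp_pos _).le]
  exact mul_le_mul_of_nonneg_left (norm_circleCoeff_le _ _) (Real.exp_pos _).le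

/-- The Fejér mean of `f ∈ 𝓕(X)`. -/
noncomputable def fejer (f : X.CalderonFun) (N : ℕ) : X.CalderonFun :=
  finsetSum (Finset.range N ×ˢ Finset.range N) fun p =>
    monomial ((p.1 : ℤ) - p.2) ((N : ℂ)⁻¹ • circleCoeff f.bdry₀ ((p.1 : ℤ) - p.2))
      ((N : ℂ)⁻¹ • f.coeff₁ ((p.1 : ℤ) - p.2))
      (by rw [map_smul, map_smul, incl₀_circleCoeff_eq_incl₁])

lemma bdry₀_fejer (f : X.CalderonFun) (N : ℕ) : (f.fejer N).bdry₀ = fejerMean f.bdry₀ N := rfl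

lemma bdry₁_fejer (f : X.CalderonFun) (N : ℕ) : (f.fejer N).bdry₁ = fejerMean f.bdry₁ N := by
  refine Finset.sum_congr rfl fun p _ => ?_
  change circleMonomial _ _ = _
  rw [smul_comm, exp_smul_coeff₁]

/-- The difference of two functions in `𝓕(X)`. -/
noncomputable def sub (f g : X.CalderonFun) : X.CalderonFun := f.add (g.smul (-1))

lemma bdry₀_sub (f g : X.CalderonFun) : (f.sub g).bdry₀ = f.bdry₀ - g.bdry₀ := by
  rw [sub_eq_add_neg, ← neg_one_smul ℂ]; rfl

lemma bdry₁_sub (f g : X.CalderonFun) : (f.sub g).bdry₁ = f.bdry₁ - g.bdry₁ := by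
  rw [sub_eq_add_neg, ← neg_one_smul ℂ]; rfl

lemma value_sub (θ : unitInterval) (f g : X.CalderonFun) :
    (f.sub g).value θ = f.value θ - g.value θ := by
  rw [sub_eq_add_neg, ← neg_one_smul ℂ (g.value θ)]; rfl

lemma value_finsetSum (θ : unitInterval) {ι : Type*} (t : Finset ι) (F : ι → X.CalderonFun) :
    (finsetSum t F).value θ = ∑ i ∈ t, (F i).value θ := by
  apply Interp.toSum_injective
  rw [map_sum]
  rfl

lemma norm_value_monomial_le (θ : unitInterval) (k : ℤ) (x₀ : X₀) (x₁ : X₁)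
    (h : X.incl₀ x₀ = X.incl₁ x₁) :
    ‖(monomial k x₀ x₁ h).value θ‖ ≤ Real.exp (k * θ) * max ‖x₀‖ ‖x₁‖ := by
  have hn : ‖expPt θ ^ k‖ = Real.exp (k * θ) := by
    rw [expPt, norm_zpow, Complex.norm_real, Real.norm_of_nonneg (Real.exp_pos _).le]
    have := Complex.exp_int_mul (θ : ℝ) k
    exact_mod_cast this.symm
  have h1 := Interp.norm_le_max ((monomial k x₀ x₁ h).value θ) (expPt θ ^ k • x₀) (expPt θ ^ k • x₁)
    (by rw [map_smul]; rfl) (by rw [map_smul, map_smul, h])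
  rwa [norm_smul, norm_smul, hn, ← mul_max_of_nonneg _ _ (Real.exp_pos _).le] at h1

end CalderonFun

/-- On a totally bounded subset of `X₀`, the norm of `X₁` controls that of `X₀`: on a compact set the
topologies of `X₀` and `X₀ + X₁` agree. -/
lemma exists_norm_le_of_totallyBounded (X : BanachCouple X₀ X₁ V) {D : Set X₀}
    (hD : TotallyBounded D) {ε : ℝ} (hε : 0 < ε) :
    ∃ δ > 0, ∀ x₀ ∈ D, ∀ x₁ : X₁, X.incl₀ x₀ = X.incl₁ x₁ → ‖x₁‖ ≤ δ → ‖x₀‖ ≤ ε := by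
  have hK : IsCompact (closure D ∩ {x | ε ≤ ‖x‖}) :=
    (hD.closure.isCompact_of_isClosed isClosed_closure).inter_right
      (isClosed_le continuous_const continuous_norm)
  rcases (closure D ∩ {x | ε ≤ ‖x‖}).eq_empty_or_nonempty with he | hne
  · refine ⟨1, one_pos, fun x₀ hx _ _ _ => ?_⟩
    by_contra hc
    have : x₀ ∈ closure D ∩ {x | ε ≤ ‖x‖} := ⟨subset_closure hx, (not_le.1 hc).le⟩
    rw [he] at this
    exact this
  · obtain ⟨z, hz, hmin⟩ := hK.exists_isMinOn hne X.inclL₀.continuous.norm.continuousOn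
    have hz0 : z ≠ 0 := norm_pos_iff.1 (hε.trans_le hz.2)
    have hpos : 0 < ‖X.incl₀ z‖ :=
      norm_pos_iff.2 ((map_ne_zero_iff _ X.incl₀_injective).2 hz0)
    refine ⟨‖X.incl₀ z‖ / 2, by positivity, fun x₀ hx x₁ h hx₁ => ?_⟩
    by_contra hc
    have h1 : ‖X.incl₀ z‖ ≤ ‖X.incl₀ x₀‖ :=
      hmin (show x₀ ∈ _ from ⟨subset_closure hx, (not_le.1 hc).le⟩)
    rw [h] at h1
    linarith [X.norm_incl₁_le x₁]

/-! ### Uniform approximation by Fejér means -/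

namespace CalderonFun

/-- If the sums `∑ λ_k ĝ(k)`, `|λ_k| ≤ 1`, of a class of functions `g ∈ 𝓕(X)` lie in a totally
bounded subset of `X₀`, then the Fejér means converge to the functions at `e^θ` in the norm of `X_θ`
uniformly on the class.

The remainder `g - σ_N g` is bounded on the outer circle. On the inner circle the part with positive
frequencies is small in `X₁`, hence in `X₀` by compactness; the part with negative frequencies is
uniformly close in `X₀` to a sum with coefficients from a finite subset of `X₀ ∩ X₁`, and such a sum
is negligible on the outer circle and at `e^θ`. -/
lemma exists_norm_value_sub_fejer_le {θ : unitInterval} (hθ₀ : 0 < (θ : ℝ)) (hθ₁ : (θ : ℝ) < 1)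
    {D : Set X₀} (hD : TotallyBounded D) (hD₁ : ∀ x ∈ D, ∃ x₁, X.incl₀ x = X.incl₁ x₁) (C : ℝ)
    {G : Set X.CalderonFun} (hGC : ∀ g ∈ G, ‖g.bdry₁‖ ≤ C)
    (hGs : ∀ g ∈ G, Summable (circleCoeff g.bdry₀))
    (hGD : ∀ g ∈ G, ∀ (t : Finset ℤ) (l : ℤ → ℂ), (∀ k, ‖l k‖ ≤ 1) →
      ∑ k ∈ t, l k • circleCoeff g.bdry₀ k ∈ D) {η : ℝ} (hη : 0 < η) :
    ∃ N : ℕ, 0 < N ∧ ∀ g ∈ G, ‖g.value θ - (g.fejer N).value θ‖ ≤ η := by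
  classical
  obtain ⟨δ, hδ, hsmall⟩ := Interp.exists_norm_value_le (X₀ := X₀) (X₁ := X₁) (V := V)
    hθ₁ (2 * C + 1) (half_pos hη)
  obtain ⟨U, hUf, hUD, hU⟩ := hD.exists_finite_approx_sum ℤ (ε := δ / 3) (by positivity)
  choose! j hj using fun x (hx : x ∈ U) => hD₁ x (hUD hx)
  obtain ⟨M, hM⟩ : ∃ M : ℝ, ∀ x ∈ U, max ‖x‖ ‖j x‖ ≤ M :=
    (hUf.image fun x => max ‖x‖ ‖j x‖).bddAbove.imp fun M hM x hx => hM ⟨x, hx, rfl⟩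
  obtain ⟨ρ, hρ, hpos⟩ := X.exists_norm_le_of_totallyBounded hD (ε := δ / 3) (by positivity)
  obtain ⟨S, hS⟩ := exists_sum_abs_mul_exp_neg_le one_pos
  obtain ⟨S', hS'⟩ := exists_sum_abs_mul_exp_neg_le hθ₀
  have hlim : ∀ A ε : ℝ, 0 < ε → ∀ᶠ N : ℕ in Filter.atTop, A / N ≤ ε := fun A ε hε =>
    ((tendsto_const_div_atTop_nhds_zero_nat A).eventually (gt_mem_nhds hε)).mono fun _ h => h.le
  obtain ⟨N, h1N, h2N, h3N, hN⟩ := ((hlim (C * S) ρ hρ).and ((hlim (M * S) 1 one_pos).and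
    ((hlim (M * S') (η / 2) (half_pos hη)).and (Filter.eventually_gt_atTop 0)))).exists
  refine ⟨N, hN, fun g hg => ?_⟩
  have hC := hGC g hg
  have hC0 : 0 ≤ C := (norm_nonneg _).trans hC
  let y : ℤ → X₀ := circleCoeff g.bdry₀
  let m : ℤ → ℝ := fun k => 1 - fejerWeight N k
  have hm0 : ∀ k, 0 ≤ m k := fun k => sub_nonneg.2 (fejerWeight_le_one N k)
  have hm1 : ∀ k, m k ≤ 1 := fun k => sub_le_self _ (fejerWeight_nonneg N k)
  have hmk : ∀ k, m k ≤ |(k : ℝ)| / N := fun k => one_sub_fejerWeight_le hN k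
  obtain ⟨t₀, ht₀⟩ := (hGs g hg).exists_finset_norm_sum_smul_le (ε := δ / 3) (by positivity)
  let t : Finset ℤ := t₀.filter fun k => ¬ 0 ≤ k
  obtain ⟨v, w, hvU, hw, hvw⟩ := hU t y (hGD g hg t)
  have hvM : ∀ k, ‖v k‖ ≤ M := fun k => (le_max_left _ _).trans (hM _ (hvU k))
  have hjM : ∀ k, ‖j (v k)‖ ≤ M := fun k => (le_max_right _ _).trans (hM _ (hvU k))
  have hmw : ∀ k ∈ t, ‖((m k * w k : ℝ) : ℂ)‖ ≤ |(k : ℝ)| / N := fun k hk => by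
    rw [Complex.norm_real, Real.norm_of_nonneg (mul_nonneg (hm0 k) (hw k hk).1)]
    exact (mul_le_of_le_one_right (hm0 k) (hw k hk).2).trans (hmk k)
  have habs : ∀ k ∈ t, |(k : ℝ)| = -(k : ℝ) := fun k hk => by
    have : k < 0 := not_le.1 (Finset.mem_filter.1 hk).2
    exact abs_of_neg (by exact_mod_cast this)
  -- the approximation of the part of `g - σ_N g` with negative frequencies
  let P : X.CalderonFun := finsetSum t fun k =>
    monomial k (((m k * w k : ℝ) : ℂ) • v k) (((m k * w k : ℝ) : ℂ) • j (v k))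
      (by rw [map_smul, map_smul, hj _ (hvU k)])
  let H : X.CalderonFun := (g.sub (g.fejer N)).sub P
  have hcoeff : ∀ k, circleCoeff H.bdry₀ k =
      (m k : ℂ) • y k - if k ∈ t then ((m k * w k : ℝ) : ℂ) • v k else 0 := fun k => by
    have hP : circleCoeff P.bdry₀ k = if k ∈ t then ((m k * w k : ℝ) : ℂ) • v k else 0 := by
      change circleCoeff (∑ i ∈ t, circleMonomial i (((m i * w i : ℝ) : ℂ) • v i)) k = _
      rw [circleCoeff_sum]
      simp only [circleCoeff_circleMonomial]
      rw [Finset.sum_ite_eq']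
    rw [bdry₀_sub, bdry₀_sub, circleCoeff_sub, circleCoeff_sub, bdry₀_fejer,
      circleCoeff_fejerMean, hP]
    congr 1
    simp only [m, y]
    push_cast
    rw [sub_smul, one_smul]
  have hH₀ : ‖H.bdry₀‖ ≤ δ := by
    refine norm_le_of_norm_sum_smul_circleCoeff_le _ fun s l hl => ?_
    have hlm : ∀ k, ‖l k * (m k : ℂ)‖ ≤ 1 := fun k => by
      rw [norm_mul, Complex.norm_real, Real.norm_of_nonneg (hm0 k)]
      exact mul_le_one₀ (hl k) (hm0 k) (hm1 k)
    rw [← Finset.sum_filter_add_sum_filter_not s (fun k => 0 ≤ k),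
      ← Finset.sum_filter_add_sum_filter_not (s.filter fun k => ¬ 0 ≤ k) (fun k => k ∈ t)]
    have hA : ‖∑ k ∈ s with 0 ≤ k, l k • circleCoeff H.bdry₀ k‖ ≤ δ / 3 := by
      have e : ∑ k ∈ s with 0 ≤ k, l k • circleCoeff H.bdry₀ k =
          ∑ k ∈ s with 0 ≤ k, (l k * (m k : ℂ)) • y k := by
        refine Finset.sum_congr rfl fun k hk => ?_
        have hkt : k ∉ t := fun h => (Finset.mem_filter.1 h).2 (Finset.mem_filter.1 hk).2
        rw [hcoeff, if_neg hkt, sub_zero, smul_smul]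
      rw [e]
      refine hpos _ (hGD g hg _ _ hlm) (∑ k ∈ s with 0 ≤ k, (l k * (m k : ℂ)) • g.coeff₁ k) ?_ ?_
      · rw [map_sum, map_sum]
        refine Finset.sum_congr rfl fun k _ => ?_
        rw [map_smul, map_smul, incl₀_circleCoeff_eq_incl₁]
      · refine le_trans ?_ h1N
        have h2 : ∀ k ∈ s.filter (fun k => 0 ≤ k), ‖(l k * (m k : ℂ)) • g.coeff₁ k‖ ≤
            C / N * (|(k : ℝ)| * Real.exp (-(|(k : ℝ)| * 1))) := fun k hk => by
          have hk0 : (0 : ℝ) ≤ k := by exact_mod_cast (Finset.mem_filter.1 hk).2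
          rw [norm_smul, norm_mul, Complex.norm_real, Real.norm_of_nonneg (hm0 k)]
          calc ‖l k‖ * m k * ‖g.coeff₁ k‖
              ≤ 1 * (|(k : ℝ)| / N) * (Real.exp (-(k : ℝ)) * C) := by
                gcongr
                · exact hm0 k
                · exact hl k
                · exact hmk k
                · exact (g.norm_coeff₁_le k).trans (by gcongr)
            _ = _ := by rw [abs_of_nonneg hk0, mul_one (k : ℝ)]; ring
        refine (norm_sum_le_of_le _ h2).trans ?_
        rw [← Finset.mul_sum]
        refine (mul_le_mul_of_nonneg_left (hS _) (by positivity)).trans_eq (by ring)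
    have hB : ‖∑ k ∈ (s.filter fun k => ¬ 0 ≤ k) with k ∈ t, l k • circleCoeff H.bdry₀ k‖ ≤
        δ / 3 := by
      set r := (s.filter fun k => ¬ 0 ≤ k).filter fun k => k ∈ t
      have hrt : r ⊆ t := fun k hk => (Finset.mem_filter.1 hk).2
      have e : ∑ k ∈ r, l k • circleCoeff H.bdry₀ k =
          ∑ k ∈ t, (if k ∈ r then l k * (m k : ℂ) else 0) • (y k - (w k : ℂ) • v k) := by
        rw [← Finset.sum_subset hrt fun k _ hk => by rw [if_neg hk, zero_smul]]
        refine Finset.sum_congr rfl fun k hk => ?_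
        rw [hcoeff, if_pos (hrt hk), if_pos hk, mul_smul, smul_sub (m k : ℂ), smul_smul (m k : ℂ)]
        push_cast
        rfl
      rw [e]
      refine hvw _ fun k => ?_
      split_ifs
      · exact hlm k
      · simp
    have hC' : ‖∑ k ∈ (s.filter fun k => ¬ 0 ≤ k) with k ∉ t, l k • circleCoeff H.bdry₀ k‖ ≤
        δ / 3 := by
      have e : ∑ k ∈ (s.filter fun k => ¬ 0 ≤ k) with k ∉ t, l k • circleCoeff H.bdry₀ k =
          ∑ k ∈ (s.filter fun k => ¬ 0 ≤ k) with k ∉ t, (l k * (m k : ℂ)) • y k := by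
        refine Finset.sum_congr rfl fun k hk => ?_
        rw [hcoeff, if_neg (Finset.mem_filter.1 hk).2, sub_zero, smul_smul]
      rw [e]
      refine ht₀ _ (Finset.disjoint_left.2 fun k hk hk₀ => ?_) _ hlm
      obtain ⟨h1, h2⟩ := Finset.mem_filter.1 hk
      exact h2 (Finset.mem_filter.2 ⟨hk₀, (Finset.mem_filter.1 h1).2⟩)
    refine (norm_add_le _ _).trans ?_
    linarith [norm_add_le (∑ k ∈ (s.filter fun k => ¬ 0 ≤ k) with k ∈ t, l k • circleCoeff H.bdry₀ k)
      (∑ k ∈ (s.filter fun k => ¬ 0 ≤ k) with k ∉ t, l k • circleCoeff H.bdry₀ k)]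
  have hH₁ : ‖H.bdry₁‖ ≤ 2 * C + 1 := by
    have hP₁ : ‖P.bdry₁‖ ≤ 1 := by
      refine le_trans ?_ h2N
      have h2 : ∀ k ∈ t, ‖circleMonomial k ((Real.exp k : ℂ) • ((m k * w k : ℝ) : ℂ) • j (v k))‖ ≤
          M / N * (|(k : ℝ)| * Real.exp (-(|(k : ℝ)| * 1))) := fun k hk => by
        refine (norm_circleMonomial_le _ _).trans ?_
        rw [norm_smul, norm_smul, Complex.norm_real, Real.norm_of_nonneg (Real.exp_pos _).le]
        calc Real.exp k * (‖((m k * w k : ℝ) : ℂ)‖ * ‖j (v k)‖)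
            ≤ Real.exp k * (|(k : ℝ)| / N * M) := by
              gcongr
              · exact hmw k hk
              · exact hjM k
          _ = _ := by rw [habs k hk, mul_one, neg_neg]; ring
      refine (norm_sum_le_of_le _ h2).trans ?_
      rw [← Finset.mul_sum]
      have hM0 : 0 ≤ M := (norm_nonneg _).trans (hvM 0)
      refine (mul_le_mul_of_nonneg_left (hS _) (by positivity)).trans_eq (by ring)
    have hF₁ : ‖(g.fejer N).bdry₁‖ ≤ C := by
      rw [bdry₁_fejer]
      exact (norm_fejerMean_le _ hN).trans hC
    rw [bdry₁_sub, bdry₁_sub]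
    linarith [norm_sub_le (g.bdry₁ - (g.fejer N).bdry₁) P.bdry₁,
      norm_sub_le g.bdry₁ (g.fejer N).bdry₁]
  have hPθ : ‖P.value θ‖ ≤ η / 2 := by
    refine le_trans ?_ h3N
    rw [value_finsetSum]
    have hM0 : 0 ≤ M := (norm_nonneg _).trans (hvM 0)
    have h2 : ∀ k ∈ t, ‖(monomial k (((m k * w k : ℝ) : ℂ) • v k) (((m k * w k : ℝ) : ℂ) • j (v k))
        (by rw [map_smul, map_smul, hj _ (hvU k)]) : X.CalderonFun).value θ‖ ≤
          M / N * (|(k : ℝ)| * Real.exp (-(|(k : ℝ)| * θ))) := fun k hk => by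
      refine (norm_value_monomial_le _ _ _ _ _).trans ?_
      rw [norm_smul, norm_smul, ← mul_max_of_nonneg _ _ (norm_nonneg _)]
      calc Real.exp (k * θ) * (‖((m k * w k : ℝ) : ℂ)‖ * max ‖v k‖ ‖j (v k)‖)
          ≤ Real.exp (k * θ) * (|(k : ℝ)| / N * M) := by
            gcongr
            · exact hmw k hk
            · exact hM _ (hvU k)
        _ = _ := by rw [habs k hk, neg_mul (k : ℝ) (θ : ℝ), neg_neg]; ring
    refine (norm_sum_le_of_le _ h2).trans ?_
    rw [← Finset.mul_sum]
    refine (mul_le_mul_of_nonneg_left (hS' _) (by positivity)).trans_eq (by ring)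
  have hdec : g.value θ - (g.fejer N).value θ = H.value θ + P.value θ := by
    rw [value_sub, value_sub, sub_add_cancel]
  rw [hdec]
  linarith [norm_add_le (H.value θ) (P.value θ), hsmall X H hH₀ hH₁]

/-- A class of functions as in `exists_norm_value_sub_fejer_le` has a totally bounded set of values
at `e^θ`, since the Fejér means of fixed order involve finitely many coefficients, each of them
from a totally bounded subset of `X₀`. -/
lemma totallyBounded_image_value {θ : unitInterval} (hθ₀ : 0 < (θ : ℝ)) (hθ₁ : (θ : ℝ) < 1)
    {D : Set X₀} (hD : TotallyBounded D) (hD₁ : ∀ x ∈ D, ∃ x₁, X.incl₀ x = X.incl₁ x₁) (C : ℝ)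
    {G : Set X.CalderonFun} (hGC : ∀ g ∈ G, ‖g.bdry₁‖ ≤ C)
    (hGs : ∀ g ∈ G, Summable (circleCoeff g.bdry₀))
    (hGD : ∀ g ∈ G, ∀ (t : Finset ℤ) (l : ℤ → ℂ), (∀ k, ‖l k‖ ≤ 1) →
      ∑ k ∈ t, l k • circleCoeff g.bdry₀ k ∈ D) :
    TotallyBounded (CalderonFun.value θ '' G) := by
  refine Metric.totallyBounded_of_finite_discretization fun ε hε => ?_
  obtain ⟨N, hN, happ⟩ := exists_norm_value_sub_fejer_le hθ₀ hθ₁ hD hD₁ C hGC hGs hGD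
    (η := ε / 4) (by positivity)
  obtain ⟨δ, hδ, hsmall⟩ := Interp.exists_norm_value_le (X₀ := X₀) (X₁ := X₁) (V := V)
    hθ₁ (2 * C) (η := ε / 4) (by positivity)
  have hN' : (0 : ℝ) < N := by exact_mod_cast hN
  obtain ⟨A, hAf, hA⟩ := Metric.totallyBounded_iff.1 hD (δ / N / 2) (by positivity)
  have : Finite A := hAf
  obtain ⟨n, ⟨e⟩⟩ := Finite.exists_equiv_fin A
  have hcD : ∀ g ∈ G, ∀ k, circleCoeff g.bdry₀ k ∈ D := fun g hg k => by
    simpa using hGD g hg {k} (fun _ => 1) (by simp)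
  have hnet : ∀ x ∈ D, ∃ a : A, dist x a < δ / N / 2 := fun x hx => by
    have := hA hx
    simp only [mem_iUnion, Metric.mem_ball] at this
    obtain ⟨a, ha, h⟩ := this
    exact ⟨⟨a, ha⟩, h⟩
  choose a ha using fun (g : G) (k : ℤ) => hnet _ (hcD g g.2 k)
  choose f hfG hf using fun x : CalderonFun.value θ '' G => x.2
  refine ⟨ULift ((Fin N × Fin N) → Fin n), inferInstance,
    fun x => ⟨fun p => e (a ⟨f x, hfG x⟩ ((p.1 : ℤ) - p.2))⟩, fun x z hxz => ?_⟩
  have hclose : ∀ p ∈ Finset.range N ×ˢ Finset.range N,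
      ‖circleCoeff (f x).bdry₀ ((p.1 : ℤ) - p.2) - circleCoeff (f z).bdry₀ ((p.1 : ℤ) - p.2)‖ ≤
        δ / N := fun p hp => by
    obtain ⟨hp1, hp2⟩ := Finset.mem_product.1 hp
    have h0 := e.injective (congr_fun (congr_arg ULift.down hxz)
      (⟨p.1, Finset.mem_range.1 hp1⟩, ⟨p.2, Finset.mem_range.1 hp2⟩))
    have h1 := ha ⟨f x, hfG x⟩ ((p.1 : ℤ) - p.2)
    have h2 := ha ⟨f z, hfG z⟩ ((p.1 : ℤ) - p.2)
    dsimp only at h0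
    rw [← h0] at h2
    rw [← dist_eq_norm]
    linarith [dist_triangle_right (circleCoeff (f x).bdry₀ ((p.1 : ℤ) - p.2))
      (circleCoeff (f z).bdry₀ ((p.1 : ℤ) - p.2)) (a ⟨f x, hfG x⟩ ((p.1 : ℤ) - p.2) : X₀)]
  have hR₀ : ‖(((f x).fejer N).sub ((f z).fejer N)).bdry₀‖ ≤ δ := by
    rw [bdry₀_sub, bdry₀_fejer, bdry₀_fejer, fejerMean, fejerMean, ← Finset.sum_sub_distrib]
    have h1 : ∀ p ∈ Finset.range N ×ˢ Finset.range N,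
        ‖circleMonomial ((p.1 : ℤ) - p.2)
            ((N : ℂ)⁻¹ • circleCoeff (f x).bdry₀ ((p.1 : ℤ) - p.2)) -
          circleMonomial ((p.1 : ℤ) - p.2)
            ((N : ℂ)⁻¹ • circleCoeff (f z).bdry₀ ((p.1 : ℤ) - p.2))‖ ≤
          (N : ℝ)⁻¹ * (δ / N) := fun p hp => by
      refine (ContinuousMap.norm_le _ (by positivity)).2 fun w => ?_
      rw [ContinuousMap.sub_apply, circleMonomial_apply, circleMonomial_apply, ← smul_sub,
        ← smul_sub, norm_smul, norm_smul, norm_zpow, Circle.norm_coe, one_zpow, one_mul, norm_inv,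
        Complex.norm_natCast]
      exact mul_le_mul_of_nonneg_left (hclose p hp) (by positivity)
    refine (norm_sum_le_of_le _ h1).trans_eq ?_
    rw [Finset.sum_const, Finset.card_product, Finset.card_range, nsmul_eq_mul]
    push_cast
    field_simp
  have hR₁ : ‖(((f x).fejer N).sub ((f z).fejer N)).bdry₁‖ ≤ 2 * C := by
    rw [bdry₁_sub, bdry₁_fejer, bdry₁_fejer]
    linarith [norm_sub_le (fejerMean (f x).bdry₁ N) (fejerMean (f z).bdry₁ N),
      norm_fejerMean_le (f x).bdry₁ hN, norm_fejerMean_le (f z).bdry₁ hN,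
      hGC _ (hfG x), hGC _ (hfG z)]
  have hR := hsmall X _ hR₀ hR₁
  rw [value_sub, ← dist_eq_norm] at hR
  have hx := happ _ (hfG x)
  have hz := happ _ (hfG z)
  rw [hf, ← dist_eq_norm] at hx hz
  have h1 := dist_triangle (x : X.Interp θ) (((f x).fejer N).value θ) (z : X.Interp θ)
  have h2 := dist_triangle_right (((f x).fejer N).value θ) (z : X.Interp θ)
    (((f z).fejer N).value θ)
  linarith

end CalderonFun

end BanachCouple

/-! ### Operators which are compact from `X₀` to `Y₀` -/

theorem theorem6 {X₀ X₁ V Y₀ Y₁ W : Type*}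
    [NormedAddCommGroup X₀] [NormedSpace ℂ X₀] [CompleteSpace X₀]
    [NormedAddCommGroup X₁] [NormedSpace ℂ X₁] [CompleteSpace X₁]
    [AddCommGroup V] [Module ℂ V] [TopologicalSpace V] [IsTopologicalAddGroup V]
    [ContinuousSMul ℂ V] [T2Space V]
    [NormedAddCommGroup Y₀] [NormedSpace ℂ Y₀] [CompleteSpace Y₀]
    [NormedAddCommGroup Y₁] [NormedSpace ℂ Y₁] [CompleteSpace Y₁]
    [AddCommGroup W] [Module ℂ W] [TopologicalSpace W] [IsTopologicalAddGroup W]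
    [ContinuousSMul ℂ W] [T2Space W]
    (X : BanachCouple X₀ X₁ V) (Y : BanachCouple Y₀ Y₁ W)
    (T : BanachCouple.Hom X Y) (hT : IsCompactOperator T.map₀)
    (θ : unitInterval) (hθ₀ : 0 < (θ : ℝ)) (hθ₁ : (θ : ℝ) < 1) :
    Y.IsRelativelyCompactIn θ (T.map '' X.valueSet X.unconditionalSet θ) := by
  classical
  -- the image of the unit ball of `X₀`, restricted to `X₀ ∩ X₁`
  let D : Set Y₀ := {y | ∃ x₀ x₁, ‖x₀‖ ≤ 1 ∧ X.incl₀ x₀ = X.incl₁ x₁ ∧ T.map₀ x₀ = y}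
  have hD : TotallyBounded D := by
    refine ((hT.isCompact_closure_image_closedBall (𝕜₁ := ℂ) 1).totallyBounded).subset ?_
    rintro _ ⟨x₀, x₁, hx, -, rfl⟩
    exact subset_closure ⟨x₀, mem_closedBall_zero_iff.2 hx, rfl⟩
  have hD₁ : ∀ y ∈ D, ∃ y₁, Y.incl₀ y = Y.incl₁ y₁ := by
    rintro _ ⟨x₀, x₁, -, h, rfl⟩
    exact ⟨T.map₁ x₁, by rw [← T.map_incl₀, ← T.map_incl₁, h]⟩
  have hcoeff : ∀ (f : X.CalderonFun) (k : ℤ),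
      circleCoeff (T.compFun f).bdry₀ k = T.map₀ (circleCoeff f.bdry₀ k) := fun f k =>
    circleCoeff_comp T.map₀ f.bdry₀ k
  have htb : TotallyBounded (BanachCouple.CalderonFun.value θ '' (T.compFun '' X.unconditionalSet)) := by
    refine BanachCouple.CalderonFun.totallyBounded_image_value hθ₀ hθ₁ hD hD₁ ‖T.map₁‖ ?_ ?_ ?_
    · rintro _ ⟨f, hf, rfl⟩
      refine (ContinuousMap.norm_le _ (norm_nonneg _)).2 fun w => ?_
      refine (T.map₁.le_opNorm _).trans (mul_le_of_le_one_right (norm_nonneg _) ?_)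
      exact (f.bdry₁.norm_coe_le_norm w).trans ((le_max_right _ _).trans hf.1)
    · rintro _ ⟨f, ⟨-, ⟨a, ha, has, -⟩, -⟩, rfl⟩
      have : circleCoeff f.bdry₀ = a := funext fun k =>
        X.incl₀_injective (by rw [ha, f.coeff_eq_incl₀])
      rw [show circleCoeff (T.compFun f).bdry₀ = fun k => T.map₀ (a k) from
        funext fun k => by rw [hcoeff, this]]
      exact T.map₀.summable has
    · rintro _ ⟨f, ⟨-, ⟨a, ha, -, hlt⟩, -⟩, rfl⟩ t l hl
      have : circleCoeff f.bdry₀ = a := funext fun k =>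
        X.incl₀_injective (by rw [ha, f.coeff_eq_incl₀])
      refine ⟨∑ k ∈ t, l k • a k, ∑ k ∈ t, l k • f.coeff₁ k, ?_, ?_, ?_⟩
      · have h := hlt (fun k => if k ∈ t then l k else 0) fun k => by
          split_ifs
          · exact hl k
          · simp
        rw [tsum_eq_sum (s := t) fun k hk => by rw [if_neg hk, zero_smul]] at h
        rw [Finset.sum_congr rfl fun k hk => by rw [if_pos hk]] at h
        exact h.le
      · rw [map_sum, map_sum]
        refine Finset.sum_congr rfl fun k _ => ?_
        rw [map_smul, map_smul, ← this, f.incl₀_circleCoeff_eq_incl₁]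
      · rw [map_sum]
        refine Finset.sum_congr rfl fun k _ => ?_
        rw [map_smul, hcoeff, this]
  have himage : T.map '' X.valueSet X.unconditionalSet θ = BanachCouple.Interp.toSum ''
      (BanachCouple.CalderonFun.value θ '' (T.compFun '' X.unconditionalSet)) := by
    simp only [BanachCouple.valueSet, image_image]
    rfl
  refine ⟨?_, ?_⟩
  · rw [himage]
    exact image_subset_range _ _
  · rw [himage, preimage_image_eq _ BanachCouple.Interp.toSum_injective]
    exact htb.closure.isCompact_of_isClosed isClosed_closure
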